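/- Let $\mathcal{K}_2$ be Kleene's second model: its underlying set is Baire space $\omega^\omega$, and $(\alpha\beta)(n)=m$ iff for the least $\ell$ with $\alpha(((n)^\frown\beta)\upharpoonright\ell)\neq 0$ this value is $m+1$; $\alpha\beta$ is defined iff such an $\ell$ exists for every $n$. It is a partial combinatory algebra (pca), with elements $k,s$, hence with $\breve k=k(skk)$ and a pairing element $p$. For $X,Y\subseteq\omega^\omega$ put $X\wedge Y=\{pab: a\in X, b\in Y\}$, $X\vee Y=\{pka: a\in X\}\cup\{p\breve k b: b\in Y\}$, $X\Rightarrow Y=\{e: ea \text{ is defined and in } Y \text{ for all } a\in X\}$, $\bot=\emptyset$, $\top=\omega^\omega$ and $\ominus_D X=(X\Rightarrow D)\Rightarrow D$. Consider the two-sorted language with a sort of numbers and a sort of functions from numbers to numbers, with $0$, $S$, symbols for all primitive recursive functions, application $\alpha(n)$, and identity on both sorts, possibly expanded by new constants of the function sort, new symbols for functions from numbers to numbers, and new relation symbols. Let $\mathcal{N}^2$ interpret the number sort by $\omega$, the function sort by $\omega^\omega$, the symbols of arithmetic and application in the standard way, identity by $\|x=y\|=\top$ if $x=y$ and $\bot$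 otherwise, the new constants by elements of $\omega^\omega$, the new function symbols by recursive functions, and each new relation symbol $R$ by an arbitrary map $\overline{a}\mapsto\|R(\overline a)\|\subseteq\omega^\omega$; and let $\mathbb{Q}(n)=\{\alpha:\alpha(0)=n\}$ and $\mathbb{Q}(\alpha)=\{\alpha\}$. The modal structure $\mu[\mathcal{N}^2]$ assigns to each modal formula $\varphi$, each assignment $\overline a$ to its free variables and each $D\subseteq\omega^\omega$ a set $\|\varphi(\overline a)\|_\mu(D)\subseteq\omega^\omega$ by $$\|\varphi\|_\mu(D)=\ominus_D\|\varphi\|\ \ (\varphi\text{ atomic or }\bot),\quad \|\varphi\wedge\psi\|_\mu(D)=\|\varphi\|_\mu(D)\wedge\|\psi\|_\mu(D),\quad \|\varphi\vee\psi\|_\mu(D)=\ominus_D(\|\varphi\|_\mu(D)\vee\|\psi\|_\mu(D)),$$ $$\|\varphi\Rightarrow\psi\|_\mu(D)=(\|\varphi\|_\mu(D)\Rightarrow\|\psi\|_\mu(D)),\quad \|\exists z\,\varphi(z)\|_\mu(D)=\ominus_D\bigcup_c(\mathbb{Q}(c)\wedge\|\varphi(c)\|_\mu(D)),$$ $$\|\forall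 z\,\varphi(z)\|_\mu(D)=\bigcap_c(\mathbb{Q}(c)\Rightarrow\|\varphi(c)\|_\mu(D)),\quad \|\Box\varphi\|_\mu(D)=\ominus_D\bigcap_{Z\subseteq\omega^\omega}\|\varphi\|_\mu(Z).$$ A formula $\varphi$ is valid in $\mu[\mathcal{N}^2]$ if $\|\varphi(\overline a)\|_\mu(D)\equiv\top$ uniformly, i.e. there is one $e\in\omega^\omega$ such that for all $\overline a$, $D$ and $b\in\omega^\omega$ the application $eb$ is defined and belongs to $\|\varphi(\overline a)\|_\mu(D)$. Let $\mathsf{EA}^{\circ}$ be Peano arithmetic over the quantified modal logic $Q^{\circ}_{eq}.\mathsf{S4}$, with induction for all modal formulas. Here $Q^{\circ}_{eq}.\mathsf{S4}$ is the Hilbert system with classical propositional logic, the axioms $\mathsf{K},\mathsf{T},\mathsf{4}$, vacuous quantification $\forall x\,\varphi\Leftrightarrow\varphi$ ($x$ not free in $\varphi$), distributivity of $\forall$ over $\Rightarrow$, permutation of universal quantifiers, instantiation in the form $\forall y\,((\forall x\,\varphi(x))\Rightarrow\varphi(y))$, the duality of $\exists$ and $\forall$, the axioms $t=t$ and $s=t\Rightarrow(\varphi(t)\Rightarrow\varphi(s))$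 for terms, and the rules of modus ponens, universal generalization and necessitation. Theorem. For every such $\mathcal{N}^2$, all theorems of $\mathsf{EA}^{\circ}$ (in the two-sorted modal language of $\mathcal{N}^2$) are valid in $\mu[\mathcal{N}^2]$; and for every modal formula $\varphi(\alpha,\beta)$ of that language, possibly with further free variables, the epistemic generalized continuity principle $$[\Box\,\forall\alpha\,\exists\beta\,\Box\,\varphi(\alpha,\beta)]\ \Rightarrow\ [\exists\gamma\,\Box\,\forall\alpha\,\exists\beta\,(\gamma\alpha=\beta\ \wedge\ \Box\,\varphi(\alpha,\beta))]$$ is valid in $\mu[\mathcal{N}^2]$, where $\gamma\alpha=\beta$ abbreviates the arithmetical formula saying that for every $n$ there is $\ell$ with $\gamma(((n)^\frown\alpha)\upharpoonright\ell)=\beta(n)+1$ and $\gamma(((n)^\frown\alpha)\upharpoonright\ell_0)=0$ for all $\ell_0<\ell$. -/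

import Mathlib

universe u

namespace EpiCont

/-! ## Partial combinatory algebras and the Heyting prealgebra structure on their power sets -/

/-- Partial combinatory algebras. -/
class PCA (A : Type*) where
  app : A → A → Part A
  k : A
  s : A
  app_s_dom : ∀ a b, ((app s a).bind fun x => app x b).Dom
  app_k : ∀ a b, ((app k a).bind fun x => app x b) = Part.some a
  app_s : ∀ a b c, (((app s a).bind fun x => app x b).bind fun y => app y c) =
    (app a c).bind fun u => (app b c).bind fun v => app u v

namespace PCA

section
variable {A : Type*} [PCA A]

theorem k_dom (a : A) : (app k a).Dom := by
  have h : ((app k a).bind fun x => app x a).Dom := by rw [app_k]; trivial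
  exact h.1

theorem s_dom (a : A) : (app s a).Dom := (app_s_dom a a).1

/-- The element `ka`. -/
def kOf (a : A) : A := (app k a).get (k_dom a)

/-- The element `sa`. -/
def sOf (a : A) : A := (app s a).get (s_dom a)

theorem app_k_eq (a : A) : app k a = Part.some (kOf a) := (Part.some_get _).symm

theorem app_s_eq (a : A) : app s a = Part.some (sOf a) := (Part.some_get _).symm

theorem app_kOf (a b : A) : app (kOf a) b = Part.some a := by
  have h := app_k a b
  rwa [app_k_eq, Part.bind_some] at h

theorem sOf_dom (a b : A) : (app (sOf a) b).Dom := by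
  have h := app_s_dom a b
  rwa [app_s_eq, Part.bind_some] at h

/-- The element `sab`. -/
def sOf2 (a b : A) : A := (app (sOf a) b).get (sOf_dom a b)

theorem app_sOf (a b : A) : app (sOf a) b = Part.some (sOf2 a b) := (Part.some_get _).symm

theorem app_sOf2 (a b c : A) : app (sOf2 a b) c =
    (app a c).bind fun u => (app b c).bind fun v => app u v := by
  have h := app_s a b c
  rwa [app_s_eq, Part.bind_some, app_sOf, Part.bind_some] at h

/-- The identity combinator `skk`. -/
def i : A := sOf2 k k

/-- The element `k˘ = k(skk)`, with `k˘ab = b`. -/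
def kbar : A := kOf i

/-- The pairing combinator `λxyz.zxy`, that is
`s(s(ks)(s(kk)(s(ks)(s(k(s(skk)))k))))(kk)`. -/
def p : A :=
  sOf2 (sOf2 (kOf s) (sOf2 (kOf k) (sOf2 (kOf s) (sOf2 (kOf (sOf i)) k)))) (kOf k)

/-- The first projection `λv.vk`. -/
def p0 : A := sOf2 i (kOf k)

/-- The second projection `λv.vk˘`. -/
def p1 : A := sOf2 i (kOf kbar)

/-- The (defined) element `pab`. -/
def pair (a b : A) : Part A := (app p a).bind fun x => app x b

theorem app_i (a : A) : app i a = Part.some a := by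
  simp [i, app_sOf2, app_k_eq, app_kOf]

theorem pair_spec (a b : A) : ∃ c : A, pair a b = Part.some c ∧
    app p0 c = Part.some a ∧ app p1 c = Part.some b := by
  refine ⟨sOf2 (sOf2 i (kOf a)) (kOf b), ?_, ?_, ?_⟩
  · simp [pair, p, app_sOf2, app_kOf, app_k_eq, app_s_eq, app_sOf]
  · simp [p0, app_sOf2, app_kOf, app_k_eq, app_i]
  · simp [p1, kbar, app_sOf2, app_kOf, app_i]

/-- `e : X ⇝ Y`. -/
def Realizes (e : A) (X Y : Set A) : Prop := ∀ a ∈ X, ∃ b ∈ app e a, b ∈ Y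

/-- The meet `{pab : a ∈ X, b ∈ Y}`. -/
def meet (X Y : Set A) : Set A := {c | ∃ a ∈ X, ∃ b ∈ Y, c ∈ pair a b}

/-- The join `{pka : a ∈ X} ∪ {pk˘b : b ∈ Y}`. -/
def join (X Y : Set A) : Set A := {c | ∃ a ∈ X, c ∈ pair k a} ∪ {c | ∃ b ∈ Y, c ∈ pair kbar b}

/-- The conditional `{e : e : X ⇝ Y}`. The bottom and top elements are `∅` and `Set.univ`. -/
def cond (X Y : Set A) : Set A := {e | Realizes e X Y}

/-- The generalized double negation `⊖_D X = (X ⇒ D) ⇒ D`. -/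
def ominus (D X : Set A) : Set A := cond (cond X D) D

/-- The order on families of elements of the power set: a single element of the algebra has to
realize the reduction at every index. -/
def FamLe {ι : Type*} (f g : ι → Set A) : Prop := ∃ e : A, ∀ x, Realizes e (f x) (g x)

end

end PCA

/-! ## Kleene's second model -/

/-- Baire space. -/
abbrev Baire : Type := ℕ → ℕ

/-- The concatenation `(n)⌢β`. -/
def cat (n : ℕ) (β : Baire) : Baire
  | 0 => n
  | i + 1 => β i

/-- (The code of) the finite string `α ↾ l`; strings are identified with natural numbers through
Mathlib's primitive recursive bijection between `List ℕ` and `ℕ`. -/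
def restr (α : Baire) (l : ℕ) : ℕ := Encodable.encode ((List.range l).map α)

/-- The application of Kleene's second model: `(αβ)(n)` is found by searching for the least `l` such
that `α(((n)⌢β) ↾ l)` has a nonzero value `m + 1`, and is then `m`; the application `αβ` is defined
if this search succeeds for every `n`. -/
def Kapp (α β : Baire) : Part Baire :=
  ⟨∀ n, ∃ l, α (restr (cat n β) l) ≠ 0,
    fun h n => α (restr (cat n β) (Nat.find (h n))) - 1⟩

/-- `(αβ)(n) = m`. -/
def KVal (α β : Baire) (n m : ℕ) : Prop :=
  ∃ l, α (restr (cat n β) l) = m + 1 ∧ ∀ l' < l, α (restr (cat n β) l') = 0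

theorem KVal.unique {α β : Baire} {n m m' : ℕ} (h : KVal α β n m) (h' : KVal α β n m') :
    m = m' := by
  obtain ⟨l, h1, h2⟩ := h
  obtain ⟨l', h1', h2'⟩ := h'
  rcases lt_trichotomy l l' with hl | hl | hl
  · have := h2' l hl; omega
  · subst hl; omega
  · have := h2 l' hl; omega

theorem mem_Kapp {α β δ : Baire} : δ ∈ Kapp α β ↔ ∀ n, KVal α β n (δ n) := by
  constructor
  · rintro ⟨h, rfl⟩ n
    refine ⟨Nat.find (h n), ?_, fun l' hl' => by simpa using Nat.find_min (h n) hl'⟩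
    have := Nat.find_spec (h n)
    simp only [Kapp]; omega
  · intro h
    have hd : ∀ n, ∃ l, α (restr (cat n β) l) ≠ 0 := fun n => by
      obtain ⟨l, h1, _⟩ := h n
      exact ⟨l, by omega⟩
    refine ⟨hd, funext fun n => ?_⟩
    refine KVal.unique (α := α) (β := β) (n := n) ⟨Nat.find (hd n), ?_, fun l' hl' => by
      simpa using Nat.find_min (hd n) hl'⟩ (h n)
    have := Nat.find_spec (hd n)
    simp only [Kapp]; omega

/-- Agreement up to length `l`. -/
def Agree (l : ℕ) (α β : Baire) : Prop := ∀ i < l, α i = β i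

theorem restr_congr {α β : Baire} {l : ℕ} (h : Agree l α β) : restr α l = restr β l := by
  unfold restr
  congr 1
  exact List.map_congr_left fun i hi => h i (by simpa using hi)

theorem cat_agree {n l : ℕ} {α β : Baire} (h : Agree l α β) :
    Agree (l + 1) (cat n α) (cat n β) := by
  intro i hi
  cases i with
  | zero => rfl
  | succ i => exact h i (by omega)

theorem restr_cat_congr {n l L : ℕ} {α β : Baire} (h : Agree L α β) (hl : l ≤ L) :
    restr (cat n α) l = restr (cat n β) l :=
  restr_congr fun i hi => cat_agree h i (by omega)

open Filter in
theorem KVal.eventually {α β : Baire} {n m : ℕ} (h : KVal α β n m) :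
    ∀ᶠ L in atTop, ∀ α' β', Agree L α α' → Agree L β β' → KVal α' β' n m := by
  obtain ⟨l, h1, h2⟩ := h
  have hc : ∀ᶠ L in atTop, ∀ i ∈ Finset.range (l + 1), restr (cat n β) i < L :=
    (Finset.eventually_all _).2 fun i _ => eventually_gt_atTop _
  filter_upwards [hc, eventually_ge_atTop l] with L hL hl α' β' ha hb
  have key : ∀ i ≤ l, α' (restr (cat n β') i) = α (restr (cat n β) i) := fun i hi => by
    rw [← restr_cat_congr hb (hi.trans hl), ha _ (hL i (by simp; omega))]
  exact ⟨l, by rw [key l le_rfl, h1], fun l' hl' => by rw [key l' hl'.le, h2 l' hl']⟩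

open Classical in
theorem exists_rep (F : Baire → Baire → Baire → ℕ → ℕ → Prop)
    (hF : ∀ a b c n m m', F a b c n m → F a b c n m' → m = m')
    (ho : ∀ a b c n m, F a b c n m → ∃ L, ∀ a' b' c', Agree L a a' → Agree L b b' →
      Agree L c c' → F a' b' c' n m) :
    ∃ G : Baire → Baire → Baire, (∀ a b c n m, KVal (G a b) c n m ↔ F a b c n m) ∧
      ∀ a b x, ∃ L, ∀ a' b', Agree L a a' → Agree L b b' → G a' b' x = G a b x := by
  let P : Baire → Baire → List ℕ → ℕ → ℕ → Prop := fun a b σ n m => ∀ a' b' c',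
    Agree σ.length a a' → Agree σ.length b b' → (List.range σ.length).map c' = σ →
      F a' b' c' n m
  let H : Baire → Baire → List ℕ → ℕ := fun a b τ => match τ with
    | [] => 0
    | n :: σ => if h : ∃ m, P a b σ n m then h.choose + 1 else 0
  let G : Baire → Baire → Baire := fun a b x => H a b (Denumerable.ofNat (List ℕ) x)
  have hr : ∀ a b n c l, G a b (restr (cat n c) (l + 1)) = H a b (n :: (List.range l).map c) := by
    intro a b n c l
    simp only [G, restr, Denumerable.ofNat_encode, List.range_succ_eq_map, List.map_cons,
      List.map_map]
    rfl
  have h0 : ∀ a b n c, G a b (restr (cat n c) 0) = 0 := by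
    intro a b n c
    simp only [G, restr, Denumerable.ofNat_encode]
    rfl
  have hag : ∀ l (c c' : Baire), (List.range l).map c' = (List.range l).map c ↔ Agree l c c' := by
    intro l c c'
    simp only [List.map_inj_left, List.mem_range, Agree]
    exact ⟨fun h i hi => (h i hi).symm, fun h i hi => (h i hi).symm⟩
  have hP : ∀ a b c n m l, P a b ((List.range l).map c) n m ↔ ∀ a' b' c', Agree l a a' →
      Agree l b b' → Agree l c c' → F a' b' c' n m := by
    intro a b c n m l
    simp only [P, List.length_map, List.length_range, hag]
  refine ⟨G, ?_, ?_⟩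
  · intro a b c n m
    have hself : ∀ l m', P a b ((List.range l).map c) n m' → F a b c n m' := fun l m' h =>
      (hP ..).1 h a b c (fun _ _ => rfl) (fun _ _ => rfl) (fun _ _ => rfl)
    constructor
    · rintro ⟨l, h1, -⟩
      cases l with
      | zero => rw [h0] at h1; omega
      | succ l =>
        rw [hr] at h1
        simp only [H] at h1
        split_ifs at h1 with h
        have := hself l _ h.choose_spec
        have e : h.choose = m := by omega
        rwa [e] at this
    · intro h
      have hex : ∃ l, ∃ m, P a b ((List.range l).map c) n m := by
        obtain ⟨L, hL⟩ := ho a b c n m h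
        exact ⟨L, m, (hP ..).2 hL⟩
      refine ⟨Nat.find hex + 1, ?_, ?_⟩
      · have hs := Nat.find_spec hex
        rw [hr]
        simp only [H]
        rw [dif_pos hs]
        rw [hF a b c n _ _ (hself _ _ hs.choose_spec) h]
      · intro l' hl'
        cases l' with
        | zero => exact h0 ..
        | succ l' =>
          rw [hr]
          simp only [H]
          rw [dif_neg (Nat.find_min hex (by omega))]
  · intro a b x
    refine ⟨(Denumerable.ofNat (List ℕ) x).length, fun a' b' ha hb => ?_⟩
    simp only [G]
    generalize Denumerable.ofNat (List ℕ) x = τ at *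
    cases τ with
    | nil => rfl
    | cons n σ =>
      have e : P a' b' σ n = P a b σ n := by
        funext m
        simp only [P, eq_iff_iff]
        have ha1 : Agree σ.length a a' := fun i hi => ha i (by simp; omega)
        have hb1 : Agree σ.length b b' := fun i hi => hb i (by simp; omega)
        constructor
        · intro h a2 b2 c2 h1 h2
          exact h a2 b2 c2 (fun i hi => (ha1 i hi).symm.trans (h1 i hi))
            (fun i hi => (hb1 i hi).symm.trans (h2 i hi))
        · intro h a2 b2 c2 h1 h2
          exact h a2 b2 c2 (fun i hi => (ha1 i hi).trans (h1 i hi))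
            (fun i hi => (hb1 i hi).trans (h2 i hi))
      simp only [H, e]

theorem exists_curry (G : Baire → Baire → Baire)
    (hG : ∀ a b x, ∃ L, ∀ a' b', Agree L a a' → Agree L b b' → G a' b' x = G a b x) :
    ∃ δ, ∀ a, ∃ δ', δ' ∈ Kapp δ a ∧ ∀ b, G a b ∈ Kapp δ' b := by
  obtain ⟨G1, h1, h1'⟩ := exists_rep (fun _ a b n m => G a b n = m)
    (fun _ _ _ _ _ _ h h' => h.symm.trans h') (fun _ a b n m h => by
      obtain ⟨L, hL⟩ := hG a b n
      exact ⟨L, fun _ a' b' _ ha hb => (hL a' b' ha hb).trans h⟩)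
  obtain ⟨G2, h2, -⟩ := exists_rep (fun _ _ a n m => G1 0 a n = m)
    (fun _ _ _ _ _ _ h h' => h.symm.trans h') (fun _ _ a n m h => by
      obtain ⟨L, hL⟩ := h1' 0 a n
      exact ⟨L, fun _ _ a' _ _ ha => (hL 0 a' (fun _ _ => rfl) ha).trans h⟩)
  exact ⟨G2 0 0, fun a => ⟨G1 0 a, mem_Kapp.2 fun n => (h2 ..).2 rfl,
    fun b => mem_Kapp.2 fun n => (h1 ..).2 rfl⟩⟩

theorem exists_k : ∃ k, ∀ a, ∃ k', k' ∈ Kapp k a ∧ ∀ b, a ∈ Kapp k' b :=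
  exists_curry (fun a _ => a) fun a _ x => ⟨x + 1, fun a' _ h _ => (h x (by omega)).symm⟩

/-- `((ac)(bc))(n) = m`, provided that `ac` and `bc` are defined at `n`. -/
def SVal (a b c : Baire) (n m : ℕ) : Prop :=
  (∃ u, KVal a c n u) ∧ (∃ v, KVal b c n v) ∧
    ∃ (l : ℕ) (w : Baire), (∀ i < l, KVal b c i (w i)) ∧
      KVal a c (restr (cat n w) l) (m + 1) ∧ ∀ l' < l, KVal a c (restr (cat n w) l') 0

theorem SVal.unique {a b c : Baire} {n m m' : ℕ} (h : SVal a b c n m) (h' : SVal a b c n m') :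
    m = m' := by
  obtain ⟨-, -, l, w, h1, h2, h3⟩ := h
  obtain ⟨-, -, l', w', h1', h2', h3'⟩ := h'
  have hw : ∀ L, L ≤ l → L ≤ l' → restr (cat n w) L = restr (cat n w') L := fun L hL hL' =>
    restr_cat_congr (L := L) (fun i hi => (h1 i (by omega)).unique (h1' i (by omega))) le_rfl
  rcases lt_trichotomy l l' with hl | hl | hl
  · have := h3' l hl
    rw [← hw l le_rfl hl.le] at this
    exact absurd (h2.unique this) (by omega)
  · subst hl
    rw [← hw l le_rfl le_rfl] at h2'
    have := h2.unique h2'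
    omega
  · have := h3 l' hl
    rw [hw l' hl.le le_rfl] at this
    exact absurd (h2'.unique this) (by omega)

open Filter in
theorem SVal.locally {a b c : Baire} {n m : ℕ} (h : SVal a b c n m) :
    ∃ L, ∀ a' b' c', Agree L a a' → Agree L b b' → Agree L c c' → SVal a' b' c' n m := by
  obtain ⟨⟨u, hu⟩, ⟨v, hv⟩, l, w, h1, h2, h3⟩ := h
  have e1 := (Finset.eventually_all (Finset.range l)).2 fun i hi =>
    (h1 i (Finset.mem_range.1 hi)).eventually
  have e3 := (Finset.eventually_all (Finset.range l)).2 fun i hi =>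
    (h3 i (Finset.mem_range.1 hi)).eventually
  obtain ⟨L, hL1, hL2, hL3, hLu, hLv⟩ :=
    (e1.and (h2.eventually.and (e3.and (hu.eventually.and hv.eventually)))).exists
  exact ⟨L, fun a' b' c' ha hb hc => ⟨⟨u, hLu _ _ ha hc⟩, ⟨v, hLv _ _ hb hc⟩, l, w,
    fun i hi => hL1 i (Finset.mem_range.2 hi) _ _ hb hc, hL2 _ _ ha hc,
    fun i hi => hL3 i (Finset.mem_range.2 hi) _ _ ha hc⟩⟩

theorem exists_s : ∃ s, ∀ a, ∃ s', s' ∈ Kapp s a ∧ ∀ b, ∃ s'', s'' ∈ Kapp s' b ∧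
    ∀ c, Kapp s'' c = (Kapp a c).bind fun u => (Kapp b c).bind fun v => Kapp u v := by
  obtain ⟨G, h1, h2⟩ := exists_rep SVal (fun _ _ _ _ _ _ h h' => h.unique h')
    (fun _ _ _ _ _ h => h.locally)
  obtain ⟨s, hs⟩ := exists_curry G h2
  refine ⟨s, fun a => ?_⟩
  obtain ⟨s', hs1, hs2⟩ := hs a
  refine ⟨s', hs1, fun b => ⟨G a b, hs2 b, fun c => Part.ext fun d => ?_⟩⟩
  simp only [Part.mem_bind_iff, mem_Kapp, h1]
  constructor
  · intro h
    choose u hu using fun n => (h n).1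
    choose v hv using fun n => (h n).2.1
    refine ⟨u, hu, v, hv, fun n => ?_⟩
    obtain ⟨-, -, l, w, h1, h2, h3⟩ := h n
    have hw : ∀ L ≤ l, restr (cat n w) L = restr (cat n v) L := fun L hL =>
      restr_cat_congr (L := l) (fun i hi => (h1 i hi).unique (hv i)) hL
    refine ⟨l, (hu _).unique (hw l le_rfl ▸ h2), fun l' hl' => (hu _).unique ?_⟩
    exact hw l' hl'.le ▸ h3 l' hl'
  · rintro ⟨u, hu, v, hv, h⟩ n
    obtain ⟨l, h1, h2⟩ := h n
    exact ⟨⟨_, hu n⟩, ⟨_, hv n⟩, l, v, fun i _ => hv i, h1 ▸ hu _, fun l' hl' => h2 l' hl' ▸ hu _⟩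

theorem exists_k_app : ∃ k : Baire, ∀ a b, ((Kapp k a).bind fun x => Kapp x b) = Part.some a := by
  obtain ⟨k, hk⟩ := exists_k
  refine ⟨k, fun a b => ?_⟩
  obtain ⟨k', h1, h2⟩ := hk a
  rw [Part.eq_some_iff.2 h1, Part.bind_some, Part.eq_some_iff.2 (h2 b)]

theorem exists_s_app : ∃ s : Baire, (∀ a b, ((Kapp s a).bind fun x => Kapp x b).Dom) ∧
    ∀ a b c, (((Kapp s a).bind fun x => Kapp x b).bind fun y => Kapp y c) =
      (Kapp a c).bind fun u => (Kapp b c).bind fun v => Kapp u v := by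
  obtain ⟨s, hs⟩ := exists_s
  have key : ∀ a b, ∃ s'', ((Kapp s a).bind fun x => Kapp x b) = Part.some s'' ∧
      ∀ c, Kapp s'' c = (Kapp a c).bind fun u => (Kapp b c).bind fun v => Kapp u v := by
    intro a b
    obtain ⟨s', h1, h2⟩ := hs a
    obtain ⟨s'', h3, h4⟩ := h2 b
    exact ⟨s'', by rw [Part.eq_some_iff.2 h1, Part.bind_some, Part.eq_some_iff.2 h3], h4⟩
  refine ⟨s, fun a b => ?_, fun a b c => ?_⟩
  · obtain ⟨s'', h, -⟩ := key a b
    rw [h]; trivial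
  · obtain ⟨s'', h, h'⟩ := key a b
    rw [h, Part.bind_some, h']

/-- Kleene's second model is a partial combinatory algebra. -/
noncomputable instance instPCABaire : PCA Baire where
  app := Kapp
  k := exists_k_app.choose
  s := exists_s_app.choose
  app_s_dom := exists_s_app.choose_spec.1
  app_k := exists_k_app.choose_spec
  app_s := exists_s_app.choose_spec.2

/-! ## Symbols for the primitive recursive functions -/

/-- The symbols for the primitive recursive functions, one for each definition by composition and
primitive recursion from the initial functions. -/
inductive PRCode : ℕ → Type
  | zero : PRCode 0
  | succ : PRCode 1
  | proj {n : ℕ} (j : Fin n) : PRCode n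
  | comp {m n : ℕ} (f : PRCode m) (g : Fin m → PRCode n) : PRCode n
  | prec {n : ℕ} (g : PRCode n) (h : PRCode (n + 2)) : PRCode (n + 1)

/-- The primitive recursive function denoted by a symbol. -/
def PRCode.eval : {n : ℕ} → PRCode n → (Fin n → ℕ) → ℕ
  | _, .zero, _ => 0
  | _, .succ, v => v 0 + 1
  | _, .proj j, v => v j
  | _, .comp f g, v => f.eval fun j => (g j).eval v
  | _, .prec g h, v =>
    Nat.rec (g.eval (Fin.tail v))
      (fun y z => h.eval (Fin.cons y (Fin.cons z (Fin.tail v)))) (v 0)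

theorem PRCode.exists_code {n : ℕ} {f : List.Vector ℕ n → ℕ} (hf : Nat.Primrec' f) :
    ∃ c : PRCode n, ∀ v, c.eval v.get = f v := by
  induction hf with
  | zero => exact ⟨.zero, fun _ => rfl⟩
  | succ => exact ⟨.succ, fun v => by simp [PRCode.eval, List.Vector.get_zero]⟩
  | get j => exact ⟨.proj j, fun _ => rfl⟩
  | comp g _ _ ihf ihg =>
    obtain ⟨c, hc⟩ := ihf
    choose d hd using ihg
    refine ⟨.comp c d, fun v => Eq.trans ?_ (hc _)⟩
    rw [PRCode.eval]
    congr 1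
    funext j
    rw [hd, List.Vector.get_ofFn]
  | @prec n f g _ _ ihf ihg =>
    obtain ⟨c, hc⟩ := ihf
    obtain ⟨d, hd⟩ := ihg
    refine ⟨.prec c d, fun v => ?_⟩
    have ht : Fin.tail v.get = v.tail.get := by
      funext j
      simp [Fin.tail, List.Vector.get_tail_succ]
    have hcons : ∀ (m y : ℕ) (w : List.Vector ℕ m),
        (Fin.cons y w.get : Fin (m + 1) → ℕ) = (y ::ᵥ w).get := by
      intro m y w
      funext j
      refine Fin.cases ?_ (fun j => ?_) j <;> simp
    simp only [PRCode.eval, ht, hc, hcons, hd, List.Vector.get_zero]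

/-- The number of entries of the string with a given code. -/
def strLen (s : ℕ) : ℕ := (Denumerable.ofNat (List ℕ) s).length

/-- The entry with a given index of the string with a given code (`0` beyond its end). -/
def strGet (s j : ℕ) : ℕ := (Denumerable.ofNat (List ℕ) s).getD j 0

/-- The code of the initial segment of given length of the string with a given code. -/
def strTake (s l : ℕ) : ℕ := Encodable.encode ((Denumerable.ofNat (List ℕ) s).take l)

theorem exists_lenCode : ∃ c : PRCode 1, ∀ s, c.eval ![s] = strLen s := by
  obtain ⟨c, hc⟩ := PRCode.exists_code (f := fun v : List.Vector ℕ 1 => strLen v.head)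
    (Nat.Primrec'.of_prim
      (Primrec.list_length.comp ((Primrec.ofNat (List ℕ)).comp Primrec.vector_head)))
  refine ⟨c, fun s => ?_⟩
  rw [show (![s] : Fin 1 → ℕ) = (s ::ᵥ List.Vector.nil).get by funext j; fin_cases j; rfl, hc]
  rfl

theorem exists_code2 (f : ℕ → ℕ → ℕ) (hf : Primrec₂ f) :
    ∃ c : PRCode 2, ∀ x y, c.eval ![x, y] = f x y := by
  obtain ⟨c, hc⟩ := PRCode.exists_code (f := fun v : List.Vector ℕ 2 => f v.head v.tail.head)
    (Nat.Primrec'.of_prim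
      (hf.comp Primrec.vector_head (Primrec.vector_head.comp Primrec.vector_tail)))
  refine ⟨c, fun x y => ?_⟩
  rw [show (![x, y] : Fin 2 → ℕ) = (x ::ᵥ y ::ᵥ List.Vector.nil).get by
    funext j; fin_cases j <;> rfl, hc]
  rfl

theorem exists_getCode : ∃ c : PRCode 2, ∀ s j, c.eval ![s, j] = strGet s j :=
  exists_code2 _ ((Primrec.list_getD 0).comp
    ((Primrec.ofNat (List ℕ)).comp Primrec.fst) Primrec.snd)

theorem exists_takeCode : ∃ c : PRCode 2, ∀ s l, c.eval ![s, l] = strTake s l :=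
  exists_code2 _ (Primrec.encode.comp (Primrec.list_take.comp Primrec.snd
    ((Primrec.ofNat (List ℕ)).comp Primrec.fst)))

theorem exists_subCode : ∃ c : PRCode 2, ∀ x y, c.eval ![x, y] = x - y :=
  exists_code2 _ Primrec.nat_sub

/-- A symbol for the length of a coded string. -/
noncomputable def lenCode : PRCode 1 := exists_lenCode.choose

/-- A symbol for the entries of a coded string. -/
noncomputable def getCode : PRCode 2 := exists_getCode.choose

/-- A symbol for the initial segments of a coded string. -/
noncomputable def takeCode : PRCode 2 := exists_takeCode.choose

/-- A symbol for truncated subtraction. -/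
noncomputable def subCode : PRCode 2 := exists_subCode.choose

theorem lenCode_eval (s : ℕ) : lenCode.eval ![s] = strLen s := exists_lenCode.choose_spec s

theorem getCode_eval (s j : ℕ) : getCode.eval ![s, j] = strGet s j :=
  exists_getCode.choose_spec s j

theorem takeCode_eval (s l : ℕ) : takeCode.eval ![s, l] = strTake s l :=
  exists_takeCode.choose_spec s l

theorem subCode_eval (x y : ℕ) : subCode.eval ![x, y] = x - y := exists_subCode.choose_spec x y

/-! ## Two-sorted modal formulas

There are a sort of numbers and a sort of functions from numbers to numbers. Variables are de Bruijn
indices, counted separately in the two sorts: the variable `0` of a sort is bound by the innermost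
enclosing quantifier of that sort. -/

/-- The symbols that expand the language of arithmetic with a sort of functions: constants of the
function sort, number-valued functions of numbers, and relation symbols, `Rel a b` being those with
`a` arguments of the number sort and `b` arguments of the function sort. -/
structure Sig where
  Const : Type u
  Fn : ℕ → Type u
  Rel : ℕ → ℕ → Type u

/-- Terms of the function sort. -/
inductive FTerm (L : Sig.{u}) : Type u
  | var (j : ℕ) : FTerm L
  | const (c : L.Const) : FTerm L

/-- Terms of the number sort; `ap F t` is the application `F(t)`. -/
inductive NTerm (L : Sig.{u}) : Type u
  | var (j : ℕ) : NTerm L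
  | zero : NTerm L
  | succ (t : NTerm L) : NTerm L
  | prim {n : ℕ} (f : PRCode n) (ts : Fin n → NTerm L) : NTerm L
  | fn {n : ℕ} (f : L.Fn n) (ts : Fin n → NTerm L) : NTerm L
  | ap (F : FTerm L) (t : NTerm L) : NTerm L

/-- Modal formulas. The quantifiers `allN`, `exN` range over numbers and the quantifiers `allF`,
`exF` over functions. -/
inductive Formula (L : Sig.{u}) : Type u
  | eqN (t s : NTerm L) : Formula L
  | eqF (F G : FTerm L) : Formula L
  | rel {a b : ℕ} (R : L.Rel a b) (ts : Fin a → NTerm L) (Fs : Fin b → FTerm L) : Formula L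
  | bot : Formula L
  | and (φ ψ : Formula L) : Formula L
  | or (φ ψ : Formula L) : Formula L
  | imp (φ ψ : Formula L) : Formula L
  | allN (φ : Formula L) : Formula L
  | exN (φ : Formula L) : Formula L
  | allF (φ : Formula L) : Formula L
  | exF (φ : Formula L) : Formula L
  | box (φ : Formula L) : Formula L

section Syntactic
variable {L : Sig.{u}}

/-- Simultaneous substitution for the function variables. -/
def FTerm.subst (τ : ℕ → FTerm L) : FTerm L → FTerm L
  | .var j => τ j
  | .const c => .const c

/-- Simultaneous substitution for the variables of both sorts. -/
def NTerm.subst (σ : ℕ → NTerm L) (τ : ℕ → FTerm L) : NTerm L → NTerm L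
  | .var j => σ j
  | .zero => .zero
  | .succ t => .succ (t.subst σ τ)
  | .prim f ts => .prim f fun j => (ts j).subst σ τ
  | .fn f ts => .fn f fun j => (ts j).subst σ τ
  | .ap F t => .ap (F.subst τ) (t.subst σ τ)

/-- The substitution `σ` below a number quantifier. -/
def upN (σ : ℕ → NTerm L) : ℕ → NTerm L
  | 0 => .var 0
  | j + 1 => (σ j).subst (fun m => .var (m + 1)) .var

/-- The substitution `τ` below a function quantifier. -/
def upF (τ : ℕ → FTerm L) : ℕ → FTerm L
  | 0 => .var 0
  | j + 1 => (τ j).subst fun m => .var (m + 1)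

/-- The substitution `σ` for the number variables below a function quantifier. -/
def shiftF (σ : ℕ → NTerm L) (j : ℕ) : NTerm L := (σ j).subst .var fun m => .var (m + 1)

namespace Formula

/-- Simultaneous capture-avoiding substitution. -/
def subst : (ℕ → NTerm L) → (ℕ → FTerm L) → Formula L → Formula L
  | σ, τ, .eqN t s => .eqN (t.subst σ τ) (s.subst σ τ)
  | _, τ, .eqF F G => .eqF (F.subst τ) (G.subst τ)
  | σ, τ, .rel R ts Fs => .rel R (fun j => (ts j).subst σ τ) fun j => (Fs j).subst τ
  | _, _, .bot => .bot
  | σ, τ, .and φ ψ => .and (φ.subst σ τ) (ψ.subst σ τ)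
  | σ, τ, .or φ ψ => .or (φ.subst σ τ) (ψ.subst σ τ)
  | σ, τ, .imp φ ψ => .imp (φ.subst σ τ) (ψ.subst σ τ)
  | σ, τ, .allN φ => .allN (φ.subst (upN σ) τ)
  | σ, τ, .exN φ => .exN (φ.subst (upN σ) τ)
  | σ, τ, .allF φ => .allF (φ.subst (shiftF σ) (upF τ))
  | σ, τ, .exF φ => .exF (φ.subst (shiftF σ) (upF τ))
  | σ, τ, .box φ => .box (φ.subst σ τ)

/-- Negation. -/
def neg (φ : Formula L) : Formula L := φ.imp .bot

/-- Equivalence. -/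
def iff (φ ψ : Formula L) : Formula L := (φ.imp ψ).and (ψ.imp φ)

/-- `φ(t)`, the term `t` replacing the number variable `0`; the other number variables move down. -/
def instN (φ : Formula L) (t : NTerm L) : Formula L :=
  φ.subst (fun | 0 => t | j + 1 => .var j) .var

/-- `φ(F)`, the term `F` replacing the function variable `0`. -/
def instF (φ : Formula L) (F : FTerm L) : Formula L :=
  φ.subst .var fun | 0 => F | j + 1 => .var j

/-- `φ(t)`, the term `t` replacing the number variable `0`; the other variables keep their index, so
that `t` may contain the number variable `0`. -/
def replN (φ : Formula L) (t : NTerm L) : Formula L :=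
  φ.subst (fun | 0 => t | j + 1 => .var (j + 1)) .var

/-- `φ` in the context of a further number variable, which does not occur in it. -/
def liftN (φ : Formula L) : Formula L := φ.subst (fun j => .var (j + 1)) .var

/-- `φ` in the context of a further function variable, which does not occur in it. -/
def liftF (φ : Formula L) : Formula L := φ.subst .var fun j => .var (j + 1)

/-- `φ` with the number variables `0` and `1` interchanged. -/
def swapN (φ : Formula L) : Formula L :=
  φ.subst (fun | 0 => .var 1 | 1 => .var 0 | j + 2 => .var (j + 2)) .var

/-- `φ` with the function variables `0` and `1` interchanged. -/
def swapF (φ : Formula L) : Formula L :=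
  φ.subst .var fun | 0 => .var 1 | 1 => .var 0 | j + 2 => .var (j + 2)

/-- `t < s`, as the equation `(t + 1) ∸ s = 0`. -/
noncomputable def lt (t s : NTerm L) : Formula L :=
  .eqN (.prim subCode ![.succ t, s]) .zero

/-- The arithmetical formula `γα = β`: for every `n` there is a string `s` such that
* `s` is an initial segment of `(n)⌢α` (two clauses, for the entry `0` and for the entries `j + 1`),
* `γ(s) = β(n) + 1`,
* `γ(s ↾ l) = 0` for all `l` below the length of `s`. -/
noncomputable def appEq (γ α β : FTerm L) : Formula L :=
  .allN (.exN
    ((((lt .zero (.prim lenCode ![.var 0])).imp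
        (.eqN (.prim getCode ![.var 0, .zero]) (.var 1))).and
      (.allN ((lt (.succ (.var 0)) (.prim lenCode ![.var 1])).imp
        (.eqN (.prim getCode ![.var 1, .succ (.var 0)]) (.ap α (.var 0)))))).and
    ((Formula.eqN (.ap γ (.var 0)) (.succ (.ap β (.var 1)))).and
      (.allN ((lt (.var 0) (.prim lenCode ![.var 1])).imp
        (.eqN (.ap γ (.prim takeCode ![.var 1, .var 0])) .zero))))))

/-- The epistemic generalized continuity principle
`[□ ∀α ∃β □ φ(α,β)] ⇒ [∃γ □ ∀α ∃β (γα = β ∧ □ φ(α,β))]`, where `β` and `α` are the function variables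
`0` and `1` of `φ`. On the right, `γ` is the function variable `2`, so that the parameters of `φ`
move up by one. -/
noncomputable def egc (φ : Formula L) : Formula L :=
  (box (allF (exF (box φ)))).imp
    (exF (box (allF (exF ((appEq (.var 2) (.var 1) (.var 0)).and
      (box (φ.subst .var fun | 0 => .var 0 | 1 => .var 1 | j + 2 => .var (j + 3))))))))

end Formula

end Syntactic

/-! ## Epistemic arithmetic -/

open Formula in
/-- The theorems of `EA°`, that is of Peano arithmetic over the quantified modal logic with identity
`Q°_eq.S4`, formulated in the two-sorted modal language. The arithmetical axioms are taken with free
variables, from which the generalization rules yield their universal closures (only the statement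
that every nonzero number is a successor is itself taken in closed form). -/
inductive EA {L : Sig.{u}} : Formula L → Prop
  -- classical propositional logic
  | impK (φ ψ : Formula L) : EA (φ.imp (ψ.imp φ))
  | impS (φ ψ χ : Formula L) : EA ((φ.imp (ψ.imp χ)).imp ((φ.imp ψ).imp (φ.imp χ)))
  | andI (φ ψ : Formula L) : EA (φ.imp (ψ.imp (φ.and ψ)))
  | andL (φ ψ : Formula L) : EA ((φ.and ψ).imp φ)
  | andR (φ ψ : Formula L) : EA ((φ.and ψ).imp ψ)
  | orL (φ ψ : Formula L) : EA (φ.imp (φ.or ψ))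
  | orR (φ ψ : Formula L) : EA (ψ.imp (φ.or ψ))
  | orE (φ ψ χ : Formula L) : EA ((φ.imp χ).imp ((ψ.imp χ).imp ((φ.or ψ).imp χ)))
  | botE (φ : Formula L) : EA (bot.imp φ)
  | dne (φ : Formula L) : EA (φ.neg.neg.imp φ)
  | mp {φ ψ : Formula L} : EA (φ.imp ψ) → EA φ → EA ψ
  -- the modal axioms and the rule of necessitation
  | axK (φ ψ : Formula L) : EA ((box (φ.imp ψ)).imp ((box φ).imp (box ψ)))
  | axT (φ : Formula L) : EA ((box φ).imp φ)
  | ax4 (φ : Formula L) : EA ((box φ).imp (box (box φ)))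
  | nec {φ : Formula L} : EA φ → EA (box φ)
  -- vacuous quantification
  | vacN (φ : Formula L) : EA ((allN φ.liftN).iff φ)
  | vacF (φ : Formula L) : EA ((allF φ.liftF).iff φ)
  -- universal distributivity
  | distN (φ ψ : Formula L) : EA ((allN (φ.imp ψ)).imp ((allN φ).imp (allN ψ)))
  | distF (φ ψ : Formula L) : EA ((allF (φ.imp ψ)).imp ((allF φ).imp (allF ψ)))
  -- permutation
  | permNN (φ : Formula L) : EA ((allN (allN φ)).iff (allN (allN φ.swapN)))
  | permFF (φ : Formula L) : EA ((allF (allF φ)).iff (allF (allF φ.swapF)))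
  | permNF (φ : Formula L) : EA ((allN (allF φ)).iff (allF (allN φ)))
  -- universal instantiation, in the form `∀y ((∀x φ(x)) ⇒ φ(y))`
  | instN (φ : Formula L) : EA (allN ((allN φ).imp (φ.instN (.var 0))))
  | instF (φ : Formula L) : EA (allF ((allF φ).imp (φ.instF (.var 0))))
  -- universal generalization
  | genN {φ : Formula L} : EA φ → EA (allN φ)
  | genF {φ : Formula L} : EA φ → EA (allF φ)
  -- the existential quantifier
  | exN (φ : Formula L) : EA ((exN φ).iff (allN φ.neg).neg)
  | exF (φ : Formula L) : EA ((exF φ).iff (allF φ.neg).neg)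
  -- identity
  | reflN (t : NTerm L) : EA (eqN t t)
  | reflF (F : FTerm L) : EA (eqF F F)
  | substN (s t : NTerm L) (φ : Formula L) :
      EA ((eqN s t).imp ((φ.instN t).imp (φ.instN s)))
  | substF (F G : FTerm L) (φ : Formula L) :
      EA ((eqF F G).imp ((φ.instF G).imp (φ.instF F)))
  -- successor
  | succNeZero (x : ℕ) : EA (eqN (.succ (.var x)) .zero).neg
  | succInj (x y : ℕ) :
      EA ((eqN (.succ (.var x)) (.succ (.var y))).imp (eqN (.var x) (.var y)))
  | eqSucc : EA (allN ((eqN (.var 0) .zero).neg.imp (exN (eqN (.var 1) (.succ (.var 0))))))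
  -- the defining equations of the primitive recursive functions
  | primZero (ts : Fin 0 → NTerm L) : EA (eqN (.prim .zero ts) .zero)
  | primSucc (x : ℕ) : EA (eqN (.prim .succ fun _ => .var x) (.succ (.var x)))
  | primProj {n : ℕ} (j : Fin n) (x : Fin n → ℕ) :
      EA (eqN (.prim (.proj j) fun l => .var (x l)) (.var (x j)))
  | primComp {m n : ℕ} (f : PRCode m) (g : Fin m → PRCode n) (x : Fin n → ℕ) :
      EA (eqN (.prim (.comp f g) fun l => .var (x l))
        (.prim f fun j => .prim (g j) fun l => .var (x l)))
  | primRecZero {n : ℕ} (g : PRCode n) (h : PRCode (n + 2)) (x : Fin n → ℕ) :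
      EA (eqN (.prim (.prec g h) (Fin.cons .zero fun l => .var (x l)))
        (.prim g fun l => .var (x l)))
  | primRecSucc {n : ℕ} (g : PRCode n) (h : PRCode (n + 2)) (y : ℕ) (x : Fin n → ℕ) :
      EA (eqN (.prim (.prec g h) (Fin.cons (.succ (.var y)) fun l => .var (x l)))
        (.prim h (Fin.cons (.var y)
          (Fin.cons (.prim (.prec g h) (Fin.cons (.var y) fun l => .var (x l)))
            fun l => .var (x l)))))
  -- induction for all modal formulas
  | ind (φ : Formula L) :
      EA (((φ.instN .zero).and (allN (φ.imp (φ.replN (.succ (.var 0)))))).imp (allN φ))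

/-! ## The modal structure over the standard model of second-order arithmetic -/

/-- The expansions `N²` of the standard model of second-order arithmetic, in which the sorts are
interpreted by `ℕ` and by Baire space: new constants of the function sort denote elements of Baire
space, new function symbols denote recursive functions, and new relation symbols denote relations
with truth values in the power set of Kleene's second model. -/
structure Expansion (L : Sig.{u}) where
  const : L.Const → Baire
  fn : {n : ℕ} → L.Fn n → (Fin n → ℕ) → ℕ
  fn_computable : ∀ {n : ℕ} (f : L.Fn n), Computable (fn f)
  rel : {a b : ℕ} → L.Rel a b → (Fin a → ℕ) → (Fin b → Baire) → Set Baire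

/-- The quantifier on the number sort: `Q(n) = [(n)]`. -/
def QN (n : ℕ) : Set Baire := {α | α 0 = n}

/-- The quantifier on the function sort: `Q(α) = {α}`. -/
def QF (α : Baire) : Set Baire := {α}

/-- Identity is interpreted disjunctively: `⊤` if `x = y`, and `⊥` otherwise. -/
def eqVal {X : Type} (x y : X) : Set Baire := {_α | x = y}

section Semantics
variable {L : Sig.{u}} (N : Expansion L)

/-- The value of a term of the function sort. -/
def FTerm.eval (f : ℕ → Baire) : FTerm L → Baire
  | .var j => f j
  | .const c => N.const c

/-- The value of a term of the number sort. -/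
def NTerm.eval (v : ℕ → ℕ) (f : ℕ → Baire) : NTerm L → ℕ
  | .var j => v j
  | .zero => 0
  | .succ t => t.eval v f + 1
  | .prim c ts => c.eval fun j => (ts j).eval v f
  | .fn g ts => N.fn g fun j => (ts j).eval v f
  | .ap F t => (F.eval N f) (t.eval v f)

/-- The assignment `x, v 0, v 1, …`. -/
def push {X : Type} (x : X) (v : ℕ → X) : ℕ → X
  | 0 => x
  | j + 1 => v j

open PCA in
/-- The valuation `‖φ‖_μ(D)` of the modal structure `μ[N²]`, under an assignment of numbers `v` and
functions `f` to the variables. -/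
def Formula.val : Formula L → (ℕ → ℕ) → (ℕ → Baire) → Set Baire → Set Baire
  | .eqN t s, v, f, D => ominus D (eqVal (t.eval N v f) (s.eval N v f))
  | .eqF F G, _, f, D => ominus D (eqVal (F.eval N f) (G.eval N f))
  | .rel R ts Fs, v, f, D =>
      ominus D (N.rel R (fun j => (ts j).eval N v f) fun j => (Fs j).eval N f)
  | .bot, _, _, D => ominus D ∅
  | .and φ ψ, v, f, D => meet (φ.val v f D) (ψ.val v f D)
  | .or φ ψ, v, f, D => ominus D (join (φ.val v f D) (ψ.val v f D))
  | .imp φ ψ, v, f, D => cond (φ.val v f D) (ψ.val v f D)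
  | .allN φ, v, f, D => ⋂ n : ℕ, cond (QN n) (φ.val (push n v) f D)
  | .exN φ, v, f, D => ominus D (⋃ n : ℕ, meet (QN n) (φ.val (push n v) f D))
  | .allF φ, v, f, D => ⋂ α : Baire, cond (QF α) (φ.val v (push α f) D)
  | .exF φ, v, f, D => ominus D (⋃ α : Baire, meet (QF α) (φ.val v (push α f) D))
  | .box φ, v, f, D => ominus D (⋂ Z : Set Baire, φ.val v f Z)

/-- `φ` is valid in `μ[N²]`: it has top value, uniformly in the values of the free variables and in
`D`. -/
def Valid (φ : Formula L) : Prop :=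
  PCA.FamLe (fun _ : (ℕ → ℕ) × (ℕ → Baire) × Set Baire => (Set.univ : Set Baire))
      (fun x => φ.val N x.1 x.2.1 x.2.2) ∧
    PCA.FamLe (fun x : (ℕ → ℕ) × (ℕ → Baire) × Set Baire => φ.val N x.1 x.2.1 x.2.2)
      (fun _ => (Set.univ : Set Baire))

end Semantics

end EpiCont

namespace EpiCont

/-! A formula is realized when one element of $\mathcal{K}_2$ lies in its value for all assignments
and all $D$. This implies validity, so it suffices to exhibit realizers. They are written as
combinatory terms with variables, and checked by typing rules in which a type is any set of
realizers. A term does not mention the assignment or $D$, so checking it at each index separately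
gives uniformity.

Soundness of $\mathsf{EA}^{\circ}$ rests on stability (`Formula.exists_stab`): every value $X$
satisfies $\ominus_D X\le X$, uniformly. Clauses that begin with $\ominus_D$ are stable by the
multiplication of this monad, and $\wedge$, $\Rightarrow$, $\forall$ inherit stability from their
parts. As $\|\bot\|_\mu(D)$ is equivalent to $D$, stability is double negation elimination.
Necessitation holds because realizers are uniform in $D$; $\mathsf{T}$ is the inclusion of the
intersection in its member at $D$, followed by stability. Induction is primitive recursion in
$\mathcal{K}_2$ (`exists_natRec`).

The continuity principle uses the freedom in $D$, as in Friedman's translation. Opening the outer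
box of the premise gives an $a$ such that for all $\alpha$ and all $W$ the element $a\alpha$ belongs
to $\ominus_W\bigcup_\beta(\{\beta\}\wedge\ominus_W P(\alpha,\beta))$, where
$P(\alpha,\beta)=\bigcap_Z\|\varphi(\alpha,\beta)\|_\mu(Z)$. Take $W=\bigcup_\beta(\{\beta\}\wedge
P(\alpha,\beta))$, which may depend on $\alpha$. One fixed $w$ is then an admissible continuation
for all $\alpha$, so $a\alpha w\in W$: its first projection is an actual $\beta$ and its second
realizes $\varphi$ in every $Z$. Hence $\gamma=\lambda\alpha.\,p_0(a\alpha w)$ is the required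
function. That $\gamma\alpha=\beta$ is true has to be turned into a realizer, which only requires a
search for the string at which $\gamma$ answers (`exists_appEq`). -/

open PCA

/-! ## Combinatory terms and their typing -/

/-- Terms over a partial combinatory algebra, with de Bruijn variables. -/
inductive Tm (A : Type)
  | var (n : ℕ) : Tm A
  | const (a : A) : Tm A
  | app (t u : Tm A) : Tm A

namespace Tm

section
variable {A : Type} [PCA A]

/-- The partial value of a term under an assignment. -/
def eval (ρ : ℕ → A) : Tm A → Part A
  | var n => Part.some (ρ n)
  | const a => Part.some a
  | app t u => (t.eval ρ).bind fun x => (u.eval ρ).bind fun y => PCA.app x y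

/-- Bracket abstraction of the variable `0`. -/
def lam : Tm A → Tm A
  | var 0 => const i
  | var (n + 1) => app (const k) (var n)
  | const a => const (kOf a)
  -- Abstracting each part separately under `s` keeps the abstraction defined even where the body is
  -- undefined.
  | app t u => app (app (const s) t.lam) u.lam

/-- The value of an abstraction, which is always defined. -/
def clo (ρ : ℕ → A) : Tm A → A
  | var 0 => i
  | var (n + 1) => kOf (ρ n)
  | const a => kOf a
  | app t u => sOf2 (t.clo ρ) (u.clo ρ)

theorem eval_lam (ρ : ℕ → A) (t : Tm A) : t.lam.eval ρ = Part.some (t.clo ρ) := by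
  induction t with
  | var n => cases n <;> simp [lam, eval, clo, app_k_eq]
  | const a => simp [lam, eval, clo]
  | app t u iht ihu => simp [lam, eval, clo, iht, ihu, app_s_eq, app_sOf]

/-- The β-rule, as an equation of partial values: the two sides are defined together. -/
theorem app_clo (ρ : ℕ → A) (t : Tm A) (a : A) :
    PCA.app (t.clo ρ) a = t.eval (push a ρ) := by
  induction t with
  | var n => cases n <;> simp [eval, clo, app_i, app_kOf, push]
  | const b => simp [eval, clo, app_kOf]
  | app t u iht ihu => simp [eval, clo, app_sOf2, iht, ihu]

/-! ### Typing of terms by sets of realizers -/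

/-- Under the assignment `ρ`, the term `t` has a value in `X`. -/
def Ty (ρ : ℕ → A) (t : Tm A) (X : Set A) : Prop := ∃ b ∈ t.eval ρ, b ∈ X

variable {ρ : ℕ → A} {t u : Tm A} {X Y D : Set A}

theorem Ty.var {n : ℕ} (h : ρ n ∈ X) : Ty ρ (var n) X := ⟨_, Part.mem_some _, h⟩

theorem Ty.const {a : A} (h : a ∈ X) : Ty ρ (const a) X := ⟨_, Part.mem_some _, h⟩

theorem Ty.app (ht : Ty ρ t (cond X Y)) (hu : Ty ρ u X) : Ty ρ (app t u) Y := by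
  obtain ⟨x, hx, hx'⟩ := ht
  obtain ⟨y, hy, hy'⟩ := hu
  obtain ⟨z, hz, hz'⟩ := hx' y hy'
  exact ⟨z, Part.mem_bind hx (Part.mem_bind hy hz), hz'⟩

theorem clo_mem (h : ∀ a ∈ X, Ty (push a ρ) t Y) : t.clo ρ ∈ cond X Y := fun a ha => by
  rw [app_clo]; exact h a ha

theorem Ty.lam (h : ∀ a ∈ X, Ty (push a ρ) t Y) : Ty ρ t.lam (cond X Y) :=
  ⟨t.clo ρ, by rw [eval_lam]; exact Part.mem_some _, clo_mem h⟩

/-- No typing of the body is needed, since abstractions always have a value. This serves for the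
branch of a case distinction that is not taken. -/
theorem Ty.lam_univ : Ty ρ t.lam Set.univ :=
  ⟨t.clo ρ, by rw [eval_lam]; exact Part.mem_some _, trivial⟩

theorem Ty.mono (h : Ty ρ t X) (hXY : X ⊆ Y) : Ty ρ t Y := h.imp fun _ hb => ⟨hb.1, hXY hb.2⟩

/-- The pairing of two terms. -/
def pair (t u : Tm A) : Tm A := app (app (const p) t) u

/-- The first projection of a term. -/
def fst (t : Tm A) : Tm A := app (const p0) t

/-- The second projection of a term. -/
def snd (t : Tm A) : Tm A := app (const p1) t

theorem Ty.pair (ht : Ty ρ t X) (hu : Ty ρ u Y) : Ty ρ (pair t u) (meet X Y) := by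
  obtain ⟨x, hx, hx'⟩ := ht
  obtain ⟨y, hy, hy'⟩ := hu
  obtain ⟨c, hc, -⟩ := pair_spec x y
  have hc' : c ∈ PCA.pair x y := by rw [hc]; exact Part.mem_some _
  obtain ⟨d, hd, hd'⟩ := Part.mem_bind_iff.1 hc'
  exact ⟨c, Part.mem_bind (Part.mem_bind (Part.mem_some _) (Part.mem_bind hx hd))
    (Part.mem_bind hy hd'), x, hx', y, hy', hc'⟩

theorem p0_mem : (p0 : A) ∈ cond (meet X Y) X := by
  rintro c ⟨x, hx, y, hy, hc⟩
  obtain ⟨c', hc', h0, h1⟩ := pair_spec x y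
  rw [hc', Part.mem_some_iff] at hc
  subst hc
  exact ⟨x, by rw [h0]; exact Part.mem_some _, hx⟩

theorem p1_mem : (p1 : A) ∈ cond (meet X Y) Y := by
  rintro c ⟨x, hx, y, hy, hc⟩
  obtain ⟨c', hc', h0, h1⟩ := pair_spec x y
  rw [hc', Part.mem_some_iff] at hc
  subst hc
  exact ⟨y, by rw [h1]; exact Part.mem_some _, hy⟩

theorem Ty.fst (h : Ty ρ t (meet X Y)) : Ty ρ (fst t) X := (Ty.const p0_mem).app h

theorem Ty.snd (h : Ty ρ t (meet X Y)) : Ty ρ (snd t) Y := (Ty.const p1_mem).app h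

theorem i_mem (h : X ⊆ Y) : (i : A) ∈ cond X Y := fun a ha =>
  ⟨a, by rw [app_i]; exact Part.mem_some _, h ha⟩

theorem kOf_mem {a : A} (h : a ∈ Y) : kOf a ∈ cond X Y := fun b _ =>
  ⟨a, by rw [app_kOf]; exact Part.mem_some _, h⟩

theorem k_mem : (k : A) ∈ cond X (cond Y X) := fun a ha =>
  ⟨kOf a, by rw [app_k_eq]; exact Part.mem_some _, kOf_mem ha⟩

theorem kbar_mem : (kbar : A) ∈ cond Y (cond X X) := kOf_mem (i_mem subset_rfl)

/-! ### The monad `⊖_D` -/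

theorem ominus_mono (h : X ⊆ Y) : ominus D X ⊆ ominus D Y :=
  fun _ he f hf => he f fun a ha => hf a (h ha)

/-- The unit `λx.λf.fx` of the monad `⊖_D`. -/
def unit : A := (app (var 0) (var 1)).lam.clo fun _ => i

theorem unit_mem : (unit : A) ∈ cond X (ominus D X) :=
  clo_mem fun _ ha => .lam fun _ hf => .app (.var hf) (.var ha)

/-- The multiplication `λh.λf.h(λx.xf)` of the monad `⊖_D`. -/
def mult : A := (app (var 1) (app (var 0) (var 1)).lam).lam.clo fun _ => i

theorem mult_mem : (mult : A) ∈ cond (ominus D (ominus D X)) (ominus D X) :=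
  clo_mem fun _ hh => .lam fun _ hf => .app (.var hh) (.lam fun _ hx => .app (.var hx) (.var hf))

theorem Ty.unit (h : Ty ρ t X) : Ty ρ (Tm.app (Tm.const unit) t) (ominus D X) := .app (.const unit_mem) h

/-- The assignment is fixed, so the term has one value, which serves all indices; nonemptiness is
needed to know that it exists. -/
theorem exists_mem_of_ty {ι : Type*} [Nonempty ι] {X : ι → Set A} (t : Tm A)
    (h : ∀ x, Ty (fun _ => PCA.i) t (X x)) : ∃ c, ∀ x, c ∈ X x := by
  obtain ⟨c, hc, -⟩ := h (Classical.arbitrary ι)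
  refine ⟨c, fun x => ?_⟩
  obtain ⟨c', hc', h'⟩ := h x
  rwa [Part.mem_unique hc hc']

/-- Everything maps the empty set to `D`, so `i` is an admissible continuation. Together with
`Ty.to_bot` this lets falsity be treated as `D` itself. -/
theorem Ty.of_bot (h : Ty ρ t (ominus D ∅)) : Ty ρ (Tm.app t (Tm.const i)) D :=
  h.app (.const (i_mem (Set.empty_subset _)))

theorem Ty.to_bot (h : Ty ρ t D) : Ty ρ (Tm.app (Tm.const k) t) (ominus D ∅) :=
  (Ty.const k_mem).app h

end

end Tm

/-! ## Particular elements of Kleene's second model -/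

/-- Total continuous operations on Baire space are represented in Kleene's second model. -/
theorem exists_fun (g : Baire → Baire)
    (hg : ∀ c n, ∃ l, ∀ c', Agree l c c' → g c' n = g c n) :
    ∃ e : Baire, ∀ c, g c ∈ app e c := by
  obtain ⟨G, h1, -⟩ := exists_rep (fun _ _ c n m => g c n = m)
    (fun _ _ _ _ _ _ h h' => h.symm.trans h') (fun _ _ c n m h => by
      obtain ⟨l, hl⟩ := hg c n
      exact ⟨l, fun _ _ c' _ _ hc => (hl c' hc).trans h⟩)
  exact ⟨G 0 0, fun c => mem_Kapp.2 fun n => (h1 ..).2 rfl⟩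

theorem exists_pred : ∃ e : Baire, ∀ n, e ∈ cond (QN (n + 1)) (QN n) := by
  obtain ⟨e, he⟩ := exists_fun (fun c n => c n - 1) fun c n =>
    ⟨n + 1, fun c' h => by rw [h n (by omega)]⟩
  refine ⟨e, fun n c hc => ⟨_, he c, ?_⟩⟩
  have hc : c 0 = n + 1 := hc
  show c 0 - 1 = n
  omega

/-- Only the entry `c 0` is inspected, so the choice between `k` and `kbar` is continuous. The
conditional types leave the discarded argument unconstrained, although it must still be defined. -/
theorem exists_case : ∃ e : Baire, ∀ n, ∀ X Y : Set Baire,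
    e ∈ cond (QN n) (cond {a | n = 0 → a ∈ X} (cond {a | n ≠ 0 → a ∈ Y}
      (if n = 0 then X else Y))) := by
  obtain ⟨e, he⟩ := exists_fun (fun c => if c 0 = 0 then k else kbar) fun c n =>
    ⟨1, fun c' h => by rw [h 0 (by omega)]⟩
  refine ⟨e, fun n X Y c hc => ⟨_, he c, ?_⟩⟩
  have hc : c 0 = n := hc
  by_cases hn : n = 0
  · simpa [hc, hn] using Tm.k_mem
  · simpa [hc, hn] using Tm.kbar_mem

open Tm in
/-- Recursion over the natural numbers. -/
theorem exists_natRec : ∃ r : Baire, ∀ P : ℕ → Set Baire,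
    r ∈ cond (meet (P 0) (⋂ n, cond (QN n) (cond (P n) (P (n + 1)))))
      (⋂ n, cond (QN n) (P n)) := by
  obtain ⟨pr, hpr⟩ := exists_pred
  obtain ⟨cs, hcs⟩ := exists_case
  -- Recursion by self-application: variables `0`, `1`, `2` are the numeral, the recursor `w` and
  -- the data `c`. Application is strict, so both branches are delayed by a dummy abstraction, and
  -- the selected one is released by the final argument `i`.
  let body : Tm Baire := .app (.app (.app (.app (.const cs) (.var 0)) (Tm.fst (.var 3)).lam)
    (Tm.lam (.app (.app (.snd (.var 3)) (.app (.const pr) (.var 1)))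
      (.app (.app (.var 2) (.var 2)) (.app (.const pr) (.var 1)))))) (.const i)
  refine exists_mem_of_ty (Tm.lam (.app body.lam.lam body.lam.lam)) fun P => .lam fun c hc => ?_
  set ρ : ℕ → Baire := push c fun _ => i
  set w : Baire := body.lam.clo ρ
  have hww : app w w = Part.some (body.clo (push w ρ)) := by rw [app_clo, eval_lam]
  have key : ∀ n, ∀ q ∈ QN n, Ty (push q (push w ρ)) body (P n) := by
    intro n
    induction n with
    | zero =>
      intro q hq
      refine .app (.app (.app (.app (.const (hcs 0 (cond Set.univ (P 0)) Set.univ)) (.var hq)) ?_)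
        ?_) (.const (X := Set.univ) trivial)
      · exact (Ty.lam fun _ _ => .fst (.var hc)).mono fun _ h _ => h
      · exact Ty.lam_univ.mono fun _ h _ => h
    | succ n ih =>
      intro q hq
      refine .app (.app (.app (.app (.const (hcs (n + 1) Set.univ (cond Set.univ (P (n + 1)))))
        (.var hq)) ?_) ?_) (.const (X := Set.univ) trivial)
      · exact Ty.lam_univ.mono fun _ h _ => h
      · refine (Ty.lam fun x _ => ?_).mono fun _ h _ => h
        have hp : Ty (push x (push q (push w ρ))) (.app (.const pr) (.var 1)) (QN n) :=
          .app (.const (hpr n)) (.var hq)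
        refine .app (.app (.mono (.snd (.var hc)) (Set.iInter_subset _ n)) hp) (.app ?_ hp)
        -- The recursive call `w w` is defined outright, and by the induction hypothesis it sends
        -- `QN n` into `P n`.
        refine ⟨_, Part.mem_bind (Part.mem_some w) (Part.mem_bind (Part.mem_some w) ?_),
          clo_mem ih⟩
        rw [hww]; exact Part.mem_some _
  refine ⟨body.clo (push w ρ), ?_, Set.mem_iInter.2 fun n => clo_mem (key n)⟩
  simp only [eval, eval_lam, Part.bind_some]
  rw [show body.lam.clo ρ = w from rfl, hww]
  exact Part.mem_some _

/-- The search for the string that determines `(γα)(n)`. -/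
theorem exists_search : ∃ δ : Baire, ∀ γ α n l, γ (restr (cat n α) l) ≠ 0 →
    (∀ l' < l, γ (restr (cat n α) l') = 0) →
    δ ∈ cond {γ} (cond {α} (cond (QN n) (QN (restr (cat n α) l)))) := by
  -- The number `n` enters only as `q 0`; the result is a constant sequence, of which just the entry
  -- `0` matters.
  let F : Baire → Baire → Baire → ℕ → ℕ → Prop := fun γ α q _ m =>
    ∃ l, γ (restr (cat (q 0) α) l) ≠ 0 ∧
      (∀ l' < l, γ (restr (cat (q 0) α) l') = 0) ∧ m = restr (cat (q 0) α) l
  have hF : ∀ a b c n m m', F a b c n m → F a b c n m' → m = m' := by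
    rintro γ α q - m m' ⟨l, h1, h2, rfl⟩ ⟨l', h1', h2', rfl⟩
    rcases lt_trichotomy l l' with h | rfl | h
    · exact absurd (h2' l h) h1
    · rfl
    · exact absurd (h2 l' h) h1'
  have ho : ∀ a b c n m, F a b c n m → ∃ l, ∀ a' b' c', Agree l a a' → Agree l b b' →
      Agree l c c' → F a' b' c' n m := by
    rintro γ α q - m ⟨l, h1, h2, rfl⟩
    obtain ⟨L, hL⟩ : ∃ L, ∀ i ∈ Finset.range (l + 1), restr (cat (q 0) α) i < L :=
      ((Finset.eventually_all _).2 fun i _ => Filter.eventually_gt_atTop _).exists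
    -- The bound covers the entry `0` of `q`, the part of `α` that is read, and every code at which
    -- `γ` is queried.
    refine ⟨max (l + 1) L, fun γ' α' q' hγ hα hq => ?_⟩
    have hq0 : q' 0 = q 0 := (hq 0 (by omega)).symm
    have key : ∀ i ≤ l, restr (cat (q' 0) α') i = restr (cat (q 0) α) i := fun i hi => by
      rw [hq0, restr_cat_congr (L := max (l + 1) L) hα (by omega)]
    have key' : ∀ i ≤ l, γ' (restr (cat (q' 0) α') i) = γ (restr (cat (q 0) α) i) := fun i hi => by
      rw [key i hi]
      exact (hγ _ (lt_max_of_lt_right (hL i (by simp; omega)))).symm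
    exact ⟨l, by rwa [key' l le_rfl], fun l' hl' => by rw [key' l' hl'.le, h2 l' hl'],
      (key l le_rfl).symm⟩
  obtain ⟨G, h1, h2⟩ := exists_rep F hF ho
  obtain ⟨δ, hδ⟩ := exists_curry G h2
  refine ⟨δ, fun γ α n l hl hl' => ?_⟩
  rintro g hg
  obtain rfl : γ = g := hg.symm
  obtain ⟨δ', hδ', hG⟩ := hδ γ
  refine ⟨δ', hδ', ?_⟩
  rintro a ha
  obtain rfl : α = a := ha.symm
  refine ⟨_, hG α, ?_⟩
  rintro q rfl
  exact ⟨fun _ => restr (cat (q 0) α) l, mem_Kapp.2 fun x => (h1 ..).2 ⟨l, hl, hl', rfl⟩, rfl⟩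

/-! ### Typing rules for intersections, unions and joins -/

namespace Tm

section
variable {A : Type} [PCA A] {ρ : ℕ → A} {t u w : Tm A} {X Y Z : Set A}

/-- Values of terms are unique, so the members found at different indices coincide. -/
theorem Ty.iInter {ι : Type} [Nonempty ι] {X : ι → Set A} (h : ∀ x, Ty ρ t (X x)) :
    Ty ρ t (⋂ x, X x) := by
  obtain ⟨c, hc, -⟩ := h (Classical.arbitrary ι)
  refine ⟨c, hc, Set.mem_iInter.2 fun x => ?_⟩
  obtain ⟨c', hc', h'⟩ := h x
  rwa [Part.mem_unique hc hc']

theorem Ty.inst {ι : Type} {X : ι → Set A} (h : Ty ρ t (⋂ x, X x)) (x : ι) : Ty ρ t (X x) :=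
  h.mono (Set.iInter_subset X x)

theorem Ty.iUnion {ι : Type} {X : ι → Set A} (x : ι) (h : Ty ρ t (X x)) : Ty ρ t (⋃ x, X x) :=
  h.mono (Set.subset_iUnion X x)

theorem Ty.inl (h : Ty ρ t X) : Ty ρ (Tm.pair (.const k) t) (join X Y) :=
  (Ty.pair (.const (Set.mem_singleton k)) h).mono <| by
    rintro c ⟨_, rfl, a, ha, hc⟩
    exact Or.inl ⟨a, ha, hc⟩

theorem Ty.inr (h : Ty ρ t Y) : Ty ρ (Tm.pair (.const kbar) t) (join X Y) :=
  (Ty.pair (.const (Set.mem_singleton kbar)) h).mono <| by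
    rintro c ⟨_, rfl, a, ha, hc⟩
    exact Or.inr ⟨a, ha, hc⟩

/-- The elimination of a join, by `t` on the left and by `u` on the right. -/
def elim (w t u : Tm A) : Tm A := app (app (app (fst w) t) u) (snd w)

/-- The tag makes the choice itself: `k` returns the first of two arguments and `kbar` the second.
-/
theorem Ty.elim {n : ℕ} (hn : ρ n ∈ join X Y) (ht : Ty ρ t (cond X Z)) (hu : Ty ρ u (cond Y Z)) :
    Ty ρ (elim (.var n) t u) Z := by
  rcases hn with ⟨a, ha, hc⟩ | ⟨a, ha, hc⟩
  · have h : Ty ρ (.var n) (meet {k} X) := .var ⟨k, rfl, a, ha, hc⟩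
    exact .app (.app (.app (h.fst.mono (Set.singleton_subset_iff.2 k_mem)) ht) hu) h.snd
  · have h : Ty ρ (.var n) (meet {kbar} Y) := .var ⟨kbar, rfl, a, ha, hc⟩
    exact .app (.app (.app (h.fst.mono (Set.singleton_subset_iff.2 kbar_mem)) ht) hu) h.snd

end

end Tm

open Tm

/-! ## Substitution -/

section
variable {L : Sig.{u}} (N : Expansion L)

theorem FTerm.eval_subst (τ : ℕ → FTerm L) (f : ℕ → Baire) (F : FTerm L) :
    (F.subst τ).eval N f = F.eval N fun j => (τ j).eval N f := by
  cases F <;> rfl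

theorem NTerm.eval_subst (σ : ℕ → NTerm L) (τ : ℕ → FTerm L) (v : ℕ → ℕ) (f : ℕ → Baire)
    (t : NTerm L) : (t.subst σ τ).eval N v f =
      t.eval N (fun j => (σ j).eval N v f) fun j => (τ j).eval N f := by
  induction t with
  | var | zero => rfl
  | succ t ih => simp only [subst, eval, ih]
  | prim g ts ih => simp only [subst, eval, ih]
  | fn g ts ih => simp only [subst, eval, ih]
  | ap F t ih => simp only [subst, eval, ih, FTerm.eval_subst]

theorem eval_upN (σ : ℕ → NTerm L) (n : ℕ) (v : ℕ → ℕ) (f : ℕ → Baire) :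
    (fun j => (upN σ j).eval N (push n v) f) = push n fun j => (σ j).eval N v f := by
  funext j
  cases j with
  | zero => rfl
  | succ j => exact NTerm.eval_subst ..

theorem eval_upF (τ : ℕ → FTerm L) (α : Baire) (f : ℕ → Baire) :
    (fun j => (upF τ j).eval N (push α f)) = push α fun j => (τ j).eval N f := by
  funext j
  cases j with
  | zero => rfl
  | succ j => exact FTerm.eval_subst ..

theorem eval_shiftF (σ : ℕ → NTerm L) (α : Baire) (v : ℕ → ℕ) (f : ℕ → Baire) :
    (fun j => (shiftF σ j).eval N v (push α f)) = fun j => (σ j).eval N v f :=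
  funext fun _ => NTerm.eval_subst ..

theorem Formula.val_subst (φ : Formula L) : ∀ (σ : ℕ → NTerm L) (τ : ℕ → FTerm L) (v : ℕ → ℕ)
    (f : ℕ → Baire) (D : Set Baire), (φ.subst σ τ).val N v f D =
      φ.val N (fun j => (σ j).eval N v f) (fun j => (τ j).eval N f) D := by
  induction φ with
  | eqN | eqF | rel | bot => intros; simp only [subst, val, FTerm.eval_subst, NTerm.eval_subst]
  | and φ ψ ih1 ih2 | or φ ψ ih1 ih2 | imp φ ψ ih1 ih2 => intros; simp only [subst, val, ih1, ih2]
  | allN φ ih | exN φ ih => intros; simp only [subst, val, ih, eval_upN]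
  | allF φ ih | exF φ ih => intros; simp only [subst, val, ih, eval_upF, eval_shiftF]
  | box φ ih => intros; simp only [subst, val, ih]

theorem Formula.val_instN (φ : Formula L) (t : NTerm L) (v f) (D) :
    (φ.instN t).val N v f D = φ.val N (push (t.eval N v f) v) f D := by
  rw [instN, val_subst]; congr; funext j; cases j <;> rfl

theorem Formula.val_instF (φ : Formula L) (F : FTerm L) (v f) (D) :
    (φ.instF F).val N v f D = φ.val N v (push (F.eval N f) f) D := by
  rw [instF, val_subst]; congr; funext j; cases j <;> rfl

theorem Formula.val_replN (φ : Formula L) (t : NTerm L) (n v f) (D) :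
    (φ.replN t).val N (push n v) f D = φ.val N (push (t.eval N (push n v) f) v) f D := by
  rw [replN, val_subst]; congr; funext j; cases j <;> rfl

theorem Formula.val_liftN (φ : Formula L) (n v f) (D) :
    φ.liftN.val N (push n v) f D = φ.val N v f D := by
  rw [liftN, val_subst]; rfl

theorem Formula.val_liftF (φ : Formula L) (α v f) (D) :
    φ.liftF.val N v (push α f) D = φ.val N v f D := by
  rw [liftF, val_subst]; rfl

theorem Formula.val_swapN (φ : Formula L) (m n v f) (D) :
    φ.swapN.val N (push m (push n v)) f D = φ.val N (push n (push m v)) f D := by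
  rw [swapN, val_subst]; congr; funext j; rcases j with _ | _ | j <;> rfl

theorem Formula.val_swapF (φ : Formula L) (α β v f) (D) :
    φ.swapF.val N v (push α (push β f)) D = φ.val N v (push β (push α f)) D := by
  rw [swapF, val_subst]; congr; funext j; rcases j with _ | _ | j <;> rfl

/-! ## Stability -/

/-- All truth values of a modal formula are stable under `⊖_D`, uniformly. -/
theorem Formula.exists_stab (φ : Formula L) :
    ∃ e : Baire, ∀ v f D, e ∈ cond (ominus D (φ.val N v f D)) (φ.val N v f D) := by
  induction φ with
  -- These values all have the form `ominus D X`.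
  | eqN | eqF | rel | bot | or | exN | exF | box => exact ⟨mult, fun _ _ _ => mult_mem⟩
  | and φ ψ ih1 ih2 =>
    obtain ⟨e1, h1⟩ := ih1
    obtain ⟨e2, h2⟩ := ih2
    exact ⟨_, fun v f D => clo_mem (ρ := fun _ => i)
      (t := .pair (.app (.const e1) (.lam (.app (.var 1) (.lam (.app (.var 1) (.fst (.var 0)))))))
        (.app (.const e2) (.lam (.app (.var 1) (.lam (.app (.var 1) (.snd (.var 0)))))))) fun h hh =>
      .pair (.app (.const (h1 v f D)) (.lam fun g hg => .app (.var hh)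
          (.lam fun c hc => .app (.var hg) (.fst (.var hc)))))
        (.app (.const (h2 v f D)) (.lam fun g hg => .app (.var hh)
          (.lam fun c hc => .app (.var hg) (.snd (.var hc)))))⟩
  | imp φ ψ ih1 ih2 =>
    obtain ⟨e2, h2⟩ := ih2
    -- The argument `x` is fixed first; then stability of the conclusion is applied to the map `c ↦
    -- c x` under the monad. The universal quantifiers are treated in the same way, with an element
    -- of `QN n` or `QF n` for `x`.
    exact ⟨_, fun v f D => clo_mem (ρ := fun _ => i)
      (t := .lam (.app (.const e2) (.lam (.app (.var 2) (.lam (.app (.var 1)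
        (.app (.var 0) (.var 2)))))))) fun h hh =>
      .lam fun x hx => .app (.const (h2 v f D)) (.lam fun g hg => .app (.var hh)
        (.lam fun c hc => .app (.var hg) (.app (.var hc) (.var hx))))⟩
  | allN φ ih =>
    obtain ⟨e2, h2⟩ := ih
    exact ⟨_, fun v f D => clo_mem (ρ := fun _ => i)
      (t := .lam (.app (.const e2) (.lam (.app (.var 2) (.lam (.app (.var 1)
        (.app (.var 0) (.var 2)))))))) fun h hh => .iInter fun n =>
      .lam fun x hx => .app (.const (h2 (push n v) f D)) (.lam fun g hg => .app (.var hh)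
        (.lam fun c hc => .app (.var hg) (.app (.var (Set.mem_iInter.1 hc n)) (.var hx))))⟩
  | allF φ ih =>
    obtain ⟨e2, h2⟩ := ih
    exact ⟨_, fun v f D => clo_mem (ρ := fun _ => i)
      (t := .lam (.app (.const e2) (.lam (.app (.var 2) (.lam (.app (.var 1)
        (.app (.var 0) (.var 2)))))))) fun h hh => .iInter fun n =>
      .lam fun x hx => .app (.const (h2 v (push n f) D)) (.lam fun g hg => .app (.var hh)
        (.lam fun c hc => .app (.var hg) (.app (.var (Set.mem_iInter.1 hc n)) (.var hx))))⟩

/-! ## Soundness of epistemic arithmetic -/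

/-- A single element belongs to all values of the formula. -/
def Realized (φ : Formula L) : Prop := ∃ c : Baire, ∀ v f D, c ∈ φ.val N v f D

variable {N}

theorem Realized.valid {φ : Formula L} : Realized N φ → Valid N φ := fun ⟨c, hc⟩ =>
  ⟨⟨kOf c, fun x => kOf_mem (hc x.1 x.2.1 x.2.2)⟩, ⟨i, fun _ => i_mem (Set.subset_univ _)⟩⟩

theorem realized_of_ty {φ : Formula L} (t : Tm Baire)
    (h : ∀ v f D, Ty (fun _ => i) t (φ.val N v f D)) : Realized N φ := by
  obtain ⟨c, hc⟩ := exists_mem_of_ty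
    (X := fun x : (ℕ → ℕ) × (ℕ → Baire) × Set Baire => φ.val N x.1 x.2.1 x.2.2) t
    fun x => h x.1 x.2.1 x.2.2
  exact ⟨c, fun v f D => hc (v, f, D)⟩

theorem ty_eqVal {ρ : ℕ → Baire} {X : Type} {x y : X} {D : Set Baire} (h : x = y) :
    Ty ρ (.app (.const unit) (.const i)) (ominus D (eqVal x y)) := .unit (.const h)

theorem realized_eqN {t s : NTerm L} (h : ∀ v f, t.eval N v f = s.eval N v f) :
    Realized N (.eqN t s) := realized_of_ty _ fun v f _ => ty_eqVal (h v f)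

theorem realized_eqF {F G : FTerm L} (h : ∀ f, F.eval N f = G.eval N f) :
    Realized N (.eqF F G) := realized_of_ty _ fun _ f _ => ty_eqVal (h f)

/-- Replacement of equals, for families of stable sets. -/
theorem exists_replace {X : Type} (e : Baire) :
    ∃ c : Baire, ∀ (x y : X) (D : Set Baire) (P : X → Set Baire),
      (∀ x, e ∈ cond (ominus D (P x)) (P x)) →
        c ∈ cond (ominus D (eqVal x y)) (cond (P y) (P x)) := by
  refine ⟨_, fun x y D P he => clo_mem (ρ := fun _ => i) (t := .lam (.app (.const e)
    (.lam (.app (.var 2) (.lam (.app (.var 1) (.var 2))))))) fun h hh => .lam fun a ha =>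
    .app (.const (he x)) (.lam fun g hg => .app (.var hh) (.lam fun b hb => ?_))⟩
  -- An element of `eqVal x y` carries no information beyond the truth of `x = y`. The latter is
  -- available only under `ominus D`, hence the appeal to stability.
  obtain rfl : x = y := hb
  exact .app (.var hg) (.var ha)

theorem NTerm.eval_cons {n : ℕ} (t : NTerm L) (ts : Fin n → NTerm L) (v f) :
    (fun j => ((Fin.cons t ts : Fin (n + 1) → NTerm L) j).eval N v f) =
      Fin.cons (t.eval N v f) fun j => (ts j).eval N v f := by
  funext j; refine Fin.cases ?_ (fun j => ?_) j <;> rfl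

/-- Induction on derivations. The statement for open formulas is uniform in the assignment, which is
what makes both generalization and necessitation immediate. -/
theorem EA.realized {φ : Formula L} (h : EA φ) : Realized N φ := by
  induction h with
  | impK φ ψ =>
    exact realized_of_ty (.lam (.lam (.var 1))) fun v f D =>
      .lam fun a ha => .lam fun b hb => .var ha
  | impS φ ψ χ =>
    exact realized_of_ty
      (.lam (.lam (.lam (.app (.app (.var 2) (.var 0)) (.app (.var 1) (.var 0)))))) fun v f D =>
      .lam fun a ha => .lam fun b hb => .lam fun c hc =>
        .app (.app (.var ha) (.var hc)) (.app (.var hb) (.var hc))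
  | andI φ ψ =>
    exact realized_of_ty (.lam (.lam (.pair (.var 1) (.var 0)))) fun v f D =>
      .lam fun a ha => .lam fun b hb => .pair (.var ha) (.var hb)
  | andL φ ψ =>
    exact ⟨p0, fun _ _ _ => p0_mem⟩
  | andR φ ψ =>
    exact ⟨p1, fun _ _ _ => p1_mem⟩
  | orL φ ψ =>
    exact realized_of_ty (.lam (.app (.const unit) (.pair (.const k) (.var 0))))
      fun v f D => .lam fun a ha => .unit (.inl (.var ha))
  | orR φ ψ =>
    exact realized_of_ty (.lam (.app (.const unit) (.pair (.const kbar) (.var 0))))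
      fun v f D => .lam fun a ha => .unit (.inr (.var ha))
  | orE φ ψ χ =>
    obtain ⟨e, he⟩ := χ.exists_stab N
    exact realized_of_ty (.lam (.lam (.lam (.app (.const e) (.lam (.app (.var 1)
      (.lam (.app (.var 1) (.elim (.var 0) (.var 4) (.var 3)))))))))) fun v f D =>
      .lam fun a ha => .lam fun b hb => .lam fun h hh => .app (.const (he v f D))
        (.lam fun g hg => .app (.var hh) (.lam fun c hc => .app (.var hg)
          (.elim hc (.var ha) (.var hb))))
  | botE φ =>
    obtain ⟨e, he⟩ := φ.exists_stab N
    exact realized_of_ty (.const e) fun v f D => .const fun a ha =>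
      he v f D a (ominus_mono (Set.empty_subset _) ha)
  | dne φ =>
    obtain ⟨e, he⟩ := φ.exists_stab N
    exact realized_of_ty (.lam (.app (.const e) (.lam (.app (.app (.var 1)
      (.lam (.app (.const k) (.app (.var 1) (.var 0))))) (.const i))))) fun v f D =>
      .lam fun h hh => .app (.const (he v f D)) (.lam fun g hg => .of_bot (.app (.var hh)
        (.lam fun a ha => .to_bot (.app (.var hg) (.var ha)))))
  | mp _ _ ih1 ih2 =>
    obtain ⟨a, ha⟩ := ih1
    obtain ⟨b, hb⟩ := ih2
    exact realized_of_ty (.app (.const a) (.const b)) fun v f D =>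
      .app (.const (ha v f D)) (.const (hb v f D))
  | axK φ ψ =>
    exact realized_of_ty (.lam (.lam (.lam (.app (.var 2) (.lam (.app (.var 2)
      (.lam (.app (.var 2) (.app (.var 1) (.var 0)))))))))) fun v f D =>
      .lam fun h hh => .lam fun g hg => .lam fun r hr => .app (.var hh) (.lam fun a ha =>
        .app (.var hg) (.lam fun b hb => .app (.var hr) (.iInter fun Z =>
          .app (.var (Set.mem_iInter.1 ha Z)) (.var (Set.mem_iInter.1 hb Z)))))
  | axT φ =>
    obtain ⟨e, he⟩ := φ.exists_stab N
    exact realized_of_ty (.const e) fun v f D => .const fun a ha =>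
      he v f D a (ominus_mono (Set.iInter_subset _ D) ha)
  | ax4 φ =>
    exact realized_of_ty (.lam (.lam (.app (.var 1) (.lam (.app (.var 1)
      (.app (.const unit) (.var 0))))))) fun v f D =>
      .lam fun h hh => .lam fun g hg => .app (.var hh) (.lam fun a ha => .app (.var hg)
        (.iInter fun Z => .unit (.var ha)))
  | nec _ ih =>
    obtain ⟨a, ha⟩ := ih
    exact realized_of_ty (.app (.const unit) (.const a)) fun v f D =>
      .unit (.const (Set.mem_iInter.2 fun Z => ha v f Z))
  | vacN φ =>
    -- Vacuous quantifiers are removed by feeding in the zero sequence, an element of `QN 0`.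
    exact realized_of_ty (.pair (.lam (.app (.var 0) (.const fun _ => 0)))
      (.lam (.lam (.var 1)))) fun v f D =>
      .pair (.lam fun a ha => by
          rw [← φ.val_liftN N 0]
          exact .app (.var (Set.mem_iInter.1 ha 0)) (.const rfl))
        (.lam fun a ha => .iInter fun n => .lam fun b hb => .var (by rwa [φ.val_liftN]))
  | vacF φ =>
    exact realized_of_ty (.pair (.lam (.app (.var 0) (.const fun _ => 0)))
      (.lam (.lam (.var 1)))) fun v f D =>
      .pair (.lam fun a ha => by
          rw [← φ.val_liftF N fun _ => 0]
          exact .app (.var (Set.mem_iInter.1 ha fun _ => 0)) (.const rfl))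
        (.lam fun a ha => .iInter fun n => .lam fun b hb => .var (by rwa [φ.val_liftF]))
  | distN φ ψ =>
    exact realized_of_ty
      (.lam (.lam (.lam (.app (.app (.var 2) (.var 0)) (.app (.var 1) (.var 0)))))) fun v f D =>
      .lam fun a ha => .lam fun b hb => .iInter fun n => .lam fun c hc =>
        .app (.app (.var (Set.mem_iInter.1 ha n)) (.var hc)) (.app (.var (Set.mem_iInter.1 hb n)) (.var hc))
  | distF φ ψ =>
    exact realized_of_ty
      (.lam (.lam (.lam (.app (.app (.var 2) (.var 0)) (.app (.var 1) (.var 0)))))) fun v f D =>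
      .lam fun a ha => .lam fun b hb => .iInter fun n => .lam fun c hc =>
        .app (.app (.var (Set.mem_iInter.1 ha n)) (.var hc)) (.app (.var (Set.mem_iInter.1 hb n)) (.var hc))
  | permNN φ =>
    let t : Tm Baire := .lam (.lam (.lam (.app (.app (.var 2) (.var 0)) (.var 1))))
    exact realized_of_ty (.pair t t) fun v f D => .pair
      (.lam fun a ha => .iInter fun n => .lam fun b hb => .iInter fun m => .lam fun c hc => by
        rw [φ.val_swapN]
        exact .app (.inst (X := fun n => cond (QN n) (φ.val N (push n (push m v)) f D))
          (.app (.var (Set.mem_iInter.1 ha m)) (.var hc)) n) (.var hb))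
      (.lam fun a ha => .iInter fun n => .lam fun b hb => .iInter fun m => .lam fun c hc => by
        rw [← φ.val_swapN]
        exact .app (.inst (X := fun n => cond (QN n) (φ.swapN.val N (push n (push m v)) f D))
          (.app (.var (Set.mem_iInter.1 ha m)) (.var hc)) n) (.var hb))
  | permFF φ =>
    let t : Tm Baire := .lam (.lam (.lam (.app (.app (.var 2) (.var 0)) (.var 1))))
    exact realized_of_ty (.pair t t) fun v f D => .pair
      (.lam fun a ha => .iInter fun n => .lam fun b hb => .iInter fun m => .lam fun c hc => by
        rw [φ.val_swapF]
        exact .app (.inst (X := fun n => cond (QF n) (φ.val N v (push n (push m f)) D))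
          (.app (.var (Set.mem_iInter.1 ha m)) (.var hc)) n) (.var hb))
      (.lam fun a ha => .iInter fun n => .lam fun b hb => .iInter fun m => .lam fun c hc => by
        rw [← φ.val_swapF]
        exact .app (.inst (X := fun n => cond (QF n) (φ.swapF.val N v (push n (push m f)) D))
          (.app (.var (Set.mem_iInter.1 ha m)) (.var hc)) n) (.var hb))
  | permNF φ =>
    let t : Tm Baire := .lam (.lam (.lam (.app (.app (.var 2) (.var 0)) (.var 1))))
    exact realized_of_ty (.pair t t) fun v f D => .pair
      (.lam fun a ha => .iInter fun n => .lam fun b hb => .iInter fun m => .lam fun c hc =>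
        .app (.inst (X := fun n => cond (QF n) (φ.val N (push m v) (push n f) D))
          (.app (.var (Set.mem_iInter.1 ha m)) (.var hc)) n) (.var hb))
      (.lam fun a ha => .iInter fun n => .lam fun b hb => .iInter fun m => .lam fun c hc =>
        .app (.inst (X := fun n => cond (QN n) (φ.val N (push n v) (push m f) D))
          (.app (.var (Set.mem_iInter.1 ha m)) (.var hc)) n) (.var hb))
  | instN φ =>
    -- The outer quantifier supplies the element of `QN n` to which the inner one is applied; a
    -- realizer has no other access to the value of a variable.
    exact realized_of_ty (.lam (.lam (.app (.var 0) (.var 1)))) fun v f D =>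
      .iInter fun n => .lam fun a ha => .lam fun b hb => by
        rw [φ.val_instN]
        exact .app (.var (Set.mem_iInter.1 hb n)) (.var ha)
  | instF φ =>
    exact realized_of_ty (.lam (.lam (.app (.var 0) (.var 1)))) fun v f D =>
      .iInter fun n => .lam fun a ha => .lam fun b hb => by
        rw [φ.val_instF]
        exact .app (.var (Set.mem_iInter.1 hb n)) (.var ha)
  | genN _ ih | genF _ ih =>
    obtain ⟨a, ha⟩ := ih
    exact ⟨kOf a, fun v f D => Set.mem_iInter.2 fun n => kOf_mem (ha ..)⟩
  | exN φ | exF φ =>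
    exact realized_of_ty (.pair
      (.lam (.lam (.app (.const k) (.app (.var 1) (.lam (.app (.app (.app (.var 1)
        (.fst (.var 0))) (.snd (.var 0))) (.const i)))))))
      (.lam (.lam (.app (.app (.var 1) (.lam (.lam (.app (.const k)
        (.app (.var 2) (.pair (.var 1) (.var 0))))))) (.const i))))) fun v f D =>
      .pair (.lam fun e he => .lam fun h hh => .to_bot (.app (.var he) (.lam fun c hc => by
          obtain ⟨n, hn⟩ := Set.mem_iUnion.1 hc
          exact .of_bot (.app (.app (.var (Set.mem_iInter.1 hh n)) (.fst (.var hn))) (.snd (.var hn))))))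
        (.lam fun h hh => .lam fun g hg => .of_bot (.app (.var hh) (.iInter fun n =>
          .lam fun q hq => .lam fun x hx => .to_bot (.app (.var hg)
            (.iUnion n (.pair (.var hq) (.var hx)))))))
  | reflN t =>
    exact realized_eqN fun _ _ => rfl
  | reflF F =>
    exact realized_eqF fun _ => rfl
  | substN s t φ =>
    obtain ⟨e, he⟩ := φ.exists_stab N
    obtain ⟨c, hc⟩ := exists_replace (X := ℕ) e
    refine ⟨c, fun v f D => ?_⟩
    simp only [Formula.val, Formula.val_instN]
    exact hc _ _ D (fun n => φ.val N (push n v) f D) fun n => he _ _ _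
  | substF F G φ =>
    obtain ⟨e, he⟩ := φ.exists_stab N
    obtain ⟨c, hc⟩ := exists_replace (X := Baire) e
    refine ⟨c, fun v f D => ?_⟩
    simp only [Formula.val, Formula.val_instF]
    exact hc _ _ D (fun n => φ.val N v (push n f) D) fun n => he _ _ _
  | succNeZero x =>
    exact ⟨i, fun v f D => i_mem (ominus_mono fun _ h => absurd h (by
      simp [NTerm.eval, eqVal]))⟩
  | succInj x y =>
    exact ⟨i, fun v f D => i_mem (ominus_mono fun _ h => Nat.succ.inj h)⟩
  | eqSucc =>
    obtain ⟨pr, hpr⟩ := exists_pred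
    obtain ⟨cs, hcs⟩ := exists_case
    -- At zero the hypothesis is contradicted by a true equation; otherwise the predecessor is the
    -- witness. The branches are again delayed.
    refine realized_of_ty (.lam (.lam (.lam (.app (.app (.app (.app (.const cs) (.var 2))
      (.lam (.app (.app (.var 2) (.app (.const unit) (.const i))) (.const i))))
      (.lam (.app (.var 1) (.pair (.app (.const pr) (.var 3))
        (.app (.const unit) (.const i)))))) (.const i))))) fun v f D =>
      .iInter fun n => .lam fun q hq => .lam fun h hh => .lam fun g hg => ?_
    cases n with
    | zero =>
      have hh' : h ∈ cond (ominus D (eqVal 0 0)) (ominus D ∅) := hh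
      refine .app (.app (.app (.app (.const (hcs 0 (cond Set.univ D) Set.univ)) (.var hq)) ?_)
        ?_) (.const (X := Set.univ) trivial)
      · exact (Ty.lam fun _ _ => .of_bot (.app (.var hh') (ty_eqVal rfl))).mono fun _ h _ => h
      · exact Ty.lam_univ.mono fun _ h _ => h
    | succ n =>
      refine .app (.app (.app (.app (.const (hcs (n + 1) Set.univ (cond Set.univ D)))
        (.var hq)) ?_) ?_) (.const (X := Set.univ) trivial)
      · exact Ty.lam_univ.mono fun _ h _ => h
      · exact (Ty.lam fun _ _ => .app (.var hg) (.iUnion n (.pair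
          (.app (.const (hpr n)) (.var hq)) (ty_eqVal rfl)))).mono fun _ h _ => h
  | primZero ts =>
    exact realized_eqN fun _ _ => rfl
  | primSucc x =>
    exact realized_eqN fun _ _ => rfl
  | primProj j x =>
    exact realized_eqN fun _ _ => rfl
  | primComp g h x =>
    exact realized_eqN fun _ _ => rfl
  | primRecZero g h x =>
    exact realized_eqN fun _ _ => by
      simp only [NTerm.eval, NTerm.eval_cons]; rfl
  | primRecSucc g h y x =>
    exact realized_eqN fun _ _ => by
      simp only [NTerm.eval, NTerm.eval_cons]; rfl
  | ind φ =>
    obtain ⟨r, hr⟩ := exists_natRec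
    refine ⟨r, fun v f D => ?_⟩
    simp only [Formula.val, Formula.val_instN, Formula.val_replN]
    exact hr fun n => φ.val N (push n v) f D

end

/-! ## Realization of the formula `γα = β` -/

theorem strLen_restr (α : Baire) (l : ℕ) : strLen (restr α l) = l := by
  simp [strLen, restr]

theorem strGet_restr (α : Baire) {l j : ℕ} (h : j < l) : strGet (restr α l) j = α j := by
  simp [strGet, restr, h]

theorem strTake_restr (α : Baire) {l j : ℕ} (h : j ≤ l) : strTake (restr α l) j = restr α j := by
  simp [strTake, restr, ← List.map_take, List.take_range, min_eq_left h]

section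
variable {L : Sig.{u}} {N : Expansion L}

theorem NTerm.eval_lenCode (t : NTerm L) (v f) :
    (NTerm.prim lenCode ![t]).eval N v f = strLen (t.eval N v f) := by
  rw [← lenCode_eval, eval]; congr; funext j; fin_cases j; rfl

theorem NTerm.eval_prim_two (c : PRCode 2) (t s : NTerm L) (v f) :
    (NTerm.prim c ![t, s]).eval N v f = c.eval ![t.eval N v f, s.eval N v f] := by
  rw [eval]; congr; funext j; fin_cases j <;> rfl

/-- The order is expressed by an equation, and the value of an equation is `ominus D` of the empty
or the full set. A true implication between equations is therefore an inclusion. -/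
theorem i_mem_lt_imp {t s a b : NTerm L} {v f} {D : Set Baire}
    (h : t.eval N v f < s.eval N v f → a.eval N v f = b.eval N v f) :
    (i : Baire) ∈ ((Formula.lt t s).imp (.eqN a b)).val N v f D := by
  refine i_mem (ominus_mono fun _ hx => h ?_)
  have hx : (NTerm.prim subCode ![.succ t, s]).eval N v f = 0 := hx
  rw [NTerm.eval_prim_two, subCode_eval, NTerm.eval] at hx
  omega

/-- The only computational content is the string witnessing the existential quantifier, found by
`exists_search`; all other clauses are true equations or true implications between equations. The
functions `γ` and `α` are passed as arguments, because the search has to consult them. -/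
theorem exists_appEq (N : Expansion L) : ∃ e : Baire, ∀ (Γ A B : FTerm L) v f D,
    B.eval N f ∈ Kapp (Γ.eval N f) (A.eval N f) →
      e ∈ cond {Γ.eval N f} (cond {A.eval N f} ((Formula.appEq Γ A B).val N v f D)) := by
  obtain ⟨δ, hδ⟩ := exists_search
  refine ⟨_, fun Γ A B v f D h => clo_mem (ρ := fun _ => i) (t := .lam (.lam (.app (.const unit)
    (.pair (.app (.app (.app (.const δ) (.var 2)) (.var 1)) (.var 0)) (.pair
      (.pair (.const i) (.const (kOf i)))
      (.pair (.app (.const unit) (.const i)) (.const (kOf i)))))))) fun c hc =>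
    .lam fun a ha => .iInter fun n => .lam fun q hq => .unit ?_⟩
  obtain ⟨l, hl, hl'⟩ := mem_Kapp.1 h n
  refine .iUnion (restr (cat n (A.eval N f)) l) (.pair (.app (.app (.app
    (.const (hδ _ _ n l (by omega) hl')) (.var hc)) (.var ha)) (.var hq)) (.pair
      (.pair (.const (i_mem_lt_imp fun hlt => ?_))
        (.const (Set.mem_iInter.2 fun j => kOf_mem (i_mem_lt_imp fun hlt => ?_))))
      (.pair (ty_eqVal hl)
        (.const (Set.mem_iInter.2 fun j => kOf_mem (i_mem_lt_imp fun hlt => ?_))))))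
  · rw [NTerm.eval_lenCode] at hlt
    rw [NTerm.eval_prim_two, getCode_eval]
    simp only [NTerm.eval, push, strLen_restr] at hlt ⊢
    rw [strGet_restr _ hlt]; rfl
  · rw [NTerm.eval_lenCode] at hlt
    rw [NTerm.eval_prim_two, getCode_eval]
    simp only [NTerm.eval, push, strLen_restr] at hlt ⊢
    rw [strGet_restr _ hlt]; rfl
  · rw [NTerm.eval_lenCode] at hlt
    show (Γ.eval N f) ((NTerm.prim takeCode ![_, _]).eval N _ f) = 0
    rw [NTerm.eval_prim_two, takeCode_eval]
    simp only [NTerm.eval, push, strLen_restr] at hlt ⊢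
    rw [strTake_restr _ hlt.le]
    exact hl' j hlt

/-! ## The epistemic generalized continuity principle -/

theorem Formula.val_subst_egc (φ : Formula L) (α β γ : Baire) (v f) (D) :
    (φ.subst .var fun | 0 => .var 0 | 1 => .var 1 | j + 2 => .var (j + 3)).val N v
      (push β (push α (push γ f))) D = φ.val N v (push β (push α f)) D := by
  rw [val_subst]; congr; funext j; rcases j with _ | _ | j <;> rfl

theorem Formula.realized_egc (φ : Formula L) : Realized N φ.egc := by
  obtain ⟨e, he⟩ := exists_appEq N
  -- With the target set itself as the parameter of `ominus`, the inner double negation is removed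
  -- by the continuation that re-attaches the first component.
  obtain ⟨w, hw⟩ : ∃ w : Baire, ∀ P : Baire → Set Baire,
      w ∈ cond (⋃ β, meet (QF β) (ominus (⋃ β, meet (QF β) (P β)) (P β)))
        (⋃ β, meet (QF β) (P β)) :=
    exists_mem_of_ty (.lam (.app (.snd (.var 0)) (.lam (.pair (.fst (.var 1)) (.var 0)))))
      fun P => .lam fun x hx => by
        obtain ⟨β, hβ⟩ := Set.mem_iUnion.1 hx
        exact .app (.snd (.var hβ)) (.lam fun y hy => .iUnion β (.pair (.fst (.var hβ)) (.var hy)))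
  -- The term `aαw`, where `m` and `n` are the indices of `a` and `α`.
  let T (m n : ℕ) : Tm Baire := .app (.app (.var m) (.var n)) (.const w)
  refine realized_of_ty (.lam (.lam (.app (.var 1) (.lam (.app (.var 1) (.pair
    (Tm.lam (.fst (T 1 0))) (.app (.const unit) (.lam (.app (.const unit) (.pair (.fst (T 1 0))
      (.pair (.app (.app (.const e) (Tm.lam (.fst (T 2 0)))) (.var 0))
        (.app (.const unit) (.snd (T 1 0))))))))))))))
    fun v f D => .lam fun h hh => .lam fun g hg => .app (.var hh) (.lam fun a ha => ?_)
  let P : Baire → Baire → Set Baire := fun α β => ⋂ W, φ.val N v (push β (push α f)) W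
  have hT : ∀ α, ∃ β, ∀ (ρ : ℕ → Baire) m n, ρ m = a → ρ n = α →
      Ty ρ (T m n) (meet (QF β) (P α β)) := by
    intro α
    have hW : ∀ W, a ∈ cond (QF α) (ominus W (⋃ β, meet (QF β) (ominus W (P α β)))) :=
      fun W => Set.mem_iInter.1 (Set.mem_iInter.1 ha W) α
    -- Here `W` becomes the union on the right. The value `b` is determined by `a` and `α`, so `β`
    -- can be chosen independently of the context and of `Z`.
    obtain ⟨b, hb, hb'⟩ : Ty (push a (push α fun _ => i)) (T 0 1) (⋃ β, meet (QF β) (P α β)) :=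
      .app (.app (.var (hW _)) (.var rfl)) (.const (hw _))
    obtain ⟨β, hβ⟩ := Set.mem_iUnion.1 hb'
    exact ⟨β, fun ρ m n hm hn => ⟨b, by simpa [T, eval, hm, hn, push] using hb, hβ⟩⟩
  choose β hβ using hT
  set ρ : ℕ → Baire := push a (push g (push h fun _ => i))
  set γ : Baire := Tm.clo ρ (.fst (T 1 0))
  -- Since `QF β` is a singleton, the first projection is the chosen function itself and not merely
  -- a code for it.
  have hγ : ∀ α, β α ∈ Kapp γ α := fun α => by
    obtain ⟨b, hb, rfl⟩ := (hβ α (push α ρ) 1 0 rfl rfl).fst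
    rwa [← app_clo] at hb
  refine .app (.var hg) (.iUnion γ (.pair ⟨γ, by rw [eval_lam]; exact Part.mem_some _, rfl⟩
    (.unit (.iInter fun Z => .iInter fun α => .lam fun α' hα => ?_))))
  obtain rfl : α' = α := hα
  have hT := hβ α' (push α' ρ) 1 0 rfl rfl
  -- Below one more binder `a` has index `2` instead of `1`, but the closure of the abstraction is
  -- still `γ`.
  refine .unit (.iUnion (β α') (.pair hT.fst (.pair (.app (.app (.const (he (.var 2) (.var 1)
    (.var 0) v (push (β α') (push α' (push γ f))) Z (hγ α')))
      ⟨γ, by rw [eval_lam]; exact Part.mem_some _, rfl⟩) (.var rfl)) ?_)))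
  refine .unit (hT.snd.mono ?_)
  exact Set.iInter_mono fun W => (val_subst_egc φ ..).ge

end

end EpiCont

theorem theorem10 {L : EpiCont.Sig.{u}} (N : EpiCont.Expansion L) :
    (∀ φ : EpiCont.Formula L, EpiCont.EA φ → EpiCont.Valid N φ) ∧
      ∀ φ : EpiCont.Formula L, EpiCont.Valid N φ.egc :=
  ⟨fun _ h => h.realized.valid, fun φ => φ.realized_egc.valid⟩
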